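/- Let $3\le r\le p\le q$ be integers with $\frac1r+\frac1p+\frac1q<1$, and let $T$ be a triangle in the hyperbolic plane $\mathbf H$ with vertices $A,B,C$ and angles $\pi/r,\pi/p,\pi/q$ at $A,B,C$ respectively. Let $\Gamma_0(r,p,q)$ be the group generated by the reflections in the sides of $T$ and let $\Gamma(r,p,q)$ be its subgroup of orientation preserving isometries. Let $Q$ be the point at which the inscribed circle of $T$ touches the side $[A,B]$, and let $\mathcal E^*=\Gamma_0(r,p,q)\cdot Q$ be the set of the corresponding points of all triangles of the tiling of $\mathbf H$ by the images of $T$. In each triangle $gT$ of the tiling ($g\in\Gamma_0(r,p,q)$) the point $gQ$ lies on the circle centred at $gA$ and on the circle centred at $gB$, with respective radii $d(A,Q)$ and $d(B,Q)$. A circle centred at an image $v$ of $A$ (respectively of $B$) thus carries $r$ (respectively $p$) points of $\mathcal E^*$, and two of these are neighbours if the angle between them at $v$ is $2\pi/r$ (respectively $2\pi/p$). The combinatorial distance $D^*(x,y)$ of two points $x,y\in\mathcal E^*$ is the least number of edges of a path in $\mathcal E^*$ from $x$ to $y$ in which consecutive points are neighbours. For a hyperbolic element $\gamma$ of $\Gamma(r,p,q)$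 let $\lambda^*(\gamma)=\inf_{x\in\mathcal E^*}D^*(x,\gamma x)$ be its level and $l(\gamma)=\inf_{z\in\mathbf H}d(z,\gamma z)$ its translation length. Then, among the hyperbolic elements $\gamma$ of $\Gamma(r,p,q)$ with $\lambda^*(\gamma)\le 4$, the three smallest translation lengths are $l_1\le l_2\le l_3$, where \[ \begin{aligned} l_1&=2\,\mathrm{arcosh}\Bigl(2\cos\tfrac{\pi}{p}\cos\tfrac{\pi}{r}+\cos\tfrac{\pi}{q}\Bigr),\\ l_2&=2\,\mathrm{arcosh}\Bigl(2\cos\tfrac{\pi}{q}\cos\tfrac{\pi}{r}+\cos\tfrac{\pi}{p}\Bigr),\\ l_3&=2\,\mathrm{arcosh}\Bigl(2\cos\tfrac{\pi}{p}\cos\tfrac{\pi}{q}+\cos\tfrac{\pi}{r}\Bigr). \end{aligned} \] That is, $l_1\le l_2\le l_3$, each of $l_1,l_2,l_3$ is the translation length of a hyperbolic element of level at most $4$, and every hyperbolic element of level at most $4$ has translation length $l_1$, or $l_2$, or at least $l_3$. -/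

import Mathlib

open UpperHalfPlane
open scoped MatrixGroups

namespace TriangleGroup

/-! ### Plane hyperbolic geometry in the Poincare half-plane `ℍ` with its distance `dist` -/

/-- The geodesic segment `[z, w]`. -/
def segment (z w : ℍ) : Set ℍ := {x | dist z x + dist x w = dist z w}

/-- The geodesic line `(z w)` through two distinct points `z` and `w`: the points `x` such that one
of the three points `x`, `z`, `w` lies on the geodesic segment between the two others. -/
def line (z w : ℍ) : Set ℍ := {x | x ∈ segment z w ∨ w ∈ segment z x ∨ z ∈ segment x w}

/-- The image of `w` under the Cayley transform that maps `ℍ` conformally onto the unit disc and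
`z` to its centre. It maps the geodesic rays from `z` to the radii of the disc, so that
`cayley z w` is, up to a rotation that depends on `z` only, a positive multiple of the
initial direction at `z` of the geodesic from `z` to `w`. -/
noncomputable def cayley (z w : ℍ) : ℂ :=
  ((w : ℂ) - (z : ℂ)) / ((w : ℂ) - (starRingEnd ℂ) (z : ℂ))

/-- The unoriented angle, in `[0, π]`, at `z` between the geodesics from `z` to `w₁` and to `w₂`. -/
noncomputable def angle (w₁ z w₂ : ℍ) : ℝ :=
  InnerProductGeometry.angle (cayley z w₁) (cayley z w₂)

/-- `A`, `B`, `C` are the vertices of a hyperbolic triangle, with angles `α`, `β`, `γ` there. -/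
def IsTriangle (A B C : ℍ) (α β γ : ℝ) : Prop :=
  A ≠ B ∧ B ≠ C ∧ C ≠ A ∧ angle B A C = α ∧ angle C B A = β ∧ angle A C B = γ

/-- The circle with centre `I` and radius `ρ` touches the line `(z w)` at `x`. -/
def TouchesAt (I : ℍ) (ρ : ℝ) (z w x : ℍ) : Prop :=
  Metric.sphere I ρ ∩ line z w = {x}

/-- `Q` is the point at which the inscribed circle of the triangle `A B C`, that is, the circle that
touches its three sides, touches the side `[A, B]`. -/
def IsContactPoint (A B C Q : ℍ) : Prop :=
  ∃ (I : ℍ) (ρ : ℝ) (P R : ℍ), 0 < ρ ∧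
    Q ∈ segment A B ∧ P ∈ segment B C ∧ R ∈ segment C A ∧
    TouchesAt I ρ A B Q ∧ TouchesAt I ρ B C P ∧ TouchesAt I ρ C A R

/-! ### The triangle group -/

/-- `σ` is the reflection in the line `(z w)`: the isometry, other than the identity, that fixes
this line pointwise. -/
def IsReflection (z w : ℍ) (σ : ℍ ≃ᵢ ℍ) : Prop :=
  σ ≠ 1 ∧ ∀ x ∈ line z w, σ x = x

/-- The group generated by the reflections in the sides of the triangle `A B C`. -/
noncomputable def reflectionGroup (A B C : ℍ) : Subgroup (ℍ ≃ᵢ ℍ) :=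
  Subgroup.closure {σ | IsReflection A B σ ∨ IsReflection B C σ ∨ IsReflection C A σ}

/-- The group of the orientation preserving isometries of `ℍ`, which are the maps
`z ↦ (a z + b) / (c z + d)` with `a`, `b`, `c`, `d` real and `a d - b c = 1`. -/
def orientationPreserving : Subgroup (ℍ ≃ᵢ ℍ) where
  carrier := {γ | ∃ g : SL(2, ℝ), ∀ z : ℍ, γ z = g • z}
  one_mem' := ⟨1, fun z => (one_smul _ z).symm⟩
  mul_mem' := by
    rintro γ δ ⟨g, hg⟩ ⟨h, hh⟩
    refine ⟨g * h, fun z => ?_⟩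
    rw [IsometryEquiv.mul_apply, hh, hg, mul_smul]
  inv_mem' := by
    rintro γ ⟨g, hg⟩
    refine ⟨g⁻¹, fun z => γ.injective ?_⟩
    rw [IsometryEquiv.apply_inv_self, hg, smul_inv_smul]

/-- The triangle group of the triangle `A B C`. -/
noncomputable def triangleGroup (A B C : ℍ) : Subgroup (ℍ ≃ᵢ ℍ) :=
  reflectionGroup A B C ⊓ orientationPreserving

/-- `γ` is a hyperbolic element: a Moebius transformation given by a real matrix of determinant `1`
with two distinct real eigenvalues. -/
def IsHyperbolic (γ : ℍ ≃ᵢ ℍ) : Prop :=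
  ∃ g : SL(2, ℝ), (g : Matrix (Fin 2) (Fin 2) ℝ).IsHyperbolic ∧ ∀ z : ℍ, γ z = g • z

/-- The translation length of `γ`. -/
noncomputable def translationLength (γ : ℍ ≃ᵢ ℍ) : ℝ := ⨅ z : ℍ, dist z (γ z)

/-! ### The combinatorial action -/

/-- The set `E*` of the points that correspond to the point `Q` of the triangle `A B C` in the
triangles of the tiling by the images of this triangle. -/
def pointSet (A B C Q : ℍ) : Set ℍ := {x | ∃ g ∈ reflectionGroup A B C, x = g Q}

/-- `x` and `y` are neighbours on a circle whose centre is an image `v` of the vertex `V` of the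
triangle `A B C`: both are points of `E*` that lie on this circle as contact points of triangles of
the tiling with vertex `v`, and they are separated by the angle `2 π / n` at `v`. -/
def NeighboursAt (A B C Q V : ℍ) (n : ℕ) (x y : ℍ) : Prop :=
  ∃ g ∈ reflectionGroup A B C, ∃ h ∈ reflectionGroup A B C,
    g V = h V ∧ x = g Q ∧ y = h Q ∧ angle x (g V) y = 2 * Real.pi / n

/-- The graph on `E*` (the points of `ℍ` outside `E*` are isolated) whose edges join two points that
are neighbours on a circle centred at an image of `A` or at an image of `B`. -/
def contactGraph (r p : ℕ) (A B C Q : ℍ) : SimpleGraph ℍ :=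
  SimpleGraph.fromRel fun x y =>
    NeighboursAt A B C Q A r x y ∨ NeighboursAt A B C Q B p x y

/-- The level of `γ`: the least combinatorial distance, that is, the least number of edges of a path
in the graph, between a point of `E*` and its image under `γ`. -/
noncomputable def level (r p : ℕ) (A B C Q : ℍ) (γ : ℍ ≃ᵢ ℍ) : ℕ∞ :=
  ⨅ x ∈ pointSet A B C Q, (contactGraph r p A B C Q).edist x (γ x)

/-- The translation lengths of the hyperbolic elements of the triangle group of level at
most `4`. -/
def lowLevelLengths (r p : ℕ) (A B C Q : ℍ) : Set ℝ :=
  {l | ∃ γ ∈ triangleGroup A B C,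
    IsHyperbolic γ ∧ level r p A B C Q γ ≤ 4 ∧ l = translationLength γ}

end TriangleGroup

namespace TriangleGroup

/-! ### Traceless real two by two matrices as a three-dimensional quadratic space -/

/-! The geometry is turned into traces of real 2×2 matrices. A point `z` becomes the traceless
matrix `halfTurn z` of square `-1`, a line becomes a traceless unit normal `S` of square `1`, and
the reflection in the line becomes `X ↦ -S X S`. The trace form on traceless matrices is a
Lorentzian form of signature (2,1); distances, angles and incidence are read off from it
(`trace_halfTurn_mul`, `mem_line_iff`, `trace_unitNormal_mul_unitNormal`). An orientation preserving
isometry comes from a matrix in `SL(2, ℝ)`, and in the hyperbolic case its translation length is `2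
arcosh (|trace| / 2)` (`translationLength_eq`).

The stabilizer of `Q` in the reflection group consists of the identity and the reflection in the
side `[A, B]` (`eq_one_or_eq_of_apply_eq`). This is the Coxeter group argument: an element that does
not shorten under multiplication by a simple reflection sends the corresponding simple root into the
positive cone (`IsCoxeterRepresentation.apply_mem_posCone`). Hence the neighbours of `g Q` are
exactly the four points `g R Q`, with `R` a rotation by `± 2π/r` about `A` or `± 2π/p` about `B`. A
path from `g Q` to `γ g Q` with at most four edges therefore gives a word `ω` of length at most four
in these rotations with `g⁻¹ γ g Q = ω Q`. As `γ` preserves the orientation, `g⁻¹ γ g = ω`, so `γ`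
and `ω` have the same trace up to sign (`exists_trace_sq_eq`).

It remains to inspect the words of length at most four. With `x`, `y`, `z` equal to `2 cos (π/r)`,
`2 cos (π/p)`, `2 cos (π/q)`, their traces are polynomials in `x`, `y`, `z`. Up to rotation,
inversion and cancellation there are 26 words, and the absolute value of each trace is at most `2`,
or is `xy + z` or `xz + y`, or is at least `yz + x` (`isAdmissible_trace`). Discreteness matters
here: some traces would fall in between for arbitrary `x ≤ y ≤ z`, but `2 cos (π/n)` takes only the
values `1`, `√2`, the golden ratio, and values from `√3` on. -/

lemma exists_eq_of_trace_eq_zero {X : Matrix (Fin 2) (Fin 2) ℝ} (h : X.trace = 0) :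
    ∃ a b c : ℝ, X = !![a, b; c, -a] := by
  refine ⟨X 0 0, X 0 1, X 1 0, ?_⟩
  rw [Matrix.trace_fin_two] at h
  conv_lhs => rw [Matrix.eta_fin_two X]
  rw [show X 1 1 = -X 0 0 by linarith]

lemma mul_add_mul_of_trace_eq_zero {X Y : Matrix (Fin 2) (Fin 2) ℝ} (hX : X.trace = 0)
    (hY : Y.trace = 0) : X * Y + Y * X = (X * Y).trace • 1 := by
  obtain ⟨a, b, c, rfl⟩ := exists_eq_of_trace_eq_zero hX
  obtain ⟨d, e, f, rfl⟩ := exists_eq_of_trace_eq_zero hY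
  ext i j
  fin_cases i <;> fin_cases j <;> simp [Matrix.trace_fin_two] <;> ring

lemma mul_self_of_trace_eq_zero {X : Matrix (Fin 2) (Fin 2) ℝ} (hX : X.trace = 0) :
    X * X = ((X * X).trace / 2) • 1 := by
  obtain ⟨a, b, c, rfl⟩ := exists_eq_of_trace_eq_zero hX
  ext i j
  fin_cases i <;> fin_cases j <;> simp [Matrix.trace_fin_two] <;> ring

/-- Up to a constant, `(X * Y * Z).trace` is the determinant of the coordinates of the three
matrices, so its square is a multiple of their Gram determinant for the trace form. -/
lemma gram_identity {X Y Z : Matrix (Fin 2) (Fin 2) ℝ} (hX : X.trace = 0) (hY : Y.trace = 0)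
    (hZ : Z.trace = 0) :
    2 * (X * Y * Z).trace ^ 2 =
      -((X * X).trace * (Y * Y).trace * (Z * Z).trace
        + 2 * (X * Y).trace * (Y * Z).trace * (Z * X).trace
        - (X * X).trace * (Y * Z).trace ^ 2 - (Y * Y).trace * (Z * X).trace ^ 2
        - (Z * Z).trace * (X * Y).trace ^ 2) := by
  obtain ⟨a, b, c, rfl⟩ := exists_eq_of_trace_eq_zero hX
  obtain ⟨d, e, f, rfl⟩ := exists_eq_of_trace_eq_zero hY
  obtain ⟨g, h, k, rfl⟩ := exists_eq_of_trace_eq_zero hZ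
  simp [Matrix.trace_fin_two]
  ring

/-- The product of two such determinants is a mixed Gram determinant; orthogonality of `S` to `X`
and `Y` leaves a single entry in one of its rows. -/
lemma mixed_gram_identity {X Y Z S : Matrix (Fin 2) (Fin 2) ℝ} (hX : X.trace = 0)
    (hY : Y.trace = 0) (hZ : Z.trace = 0) (hS : S.trace = 0) (hSX : (S * X).trace = 0)
    (hSY : (S * Y).trace = 0) :
    2 * (X * Y * S).trace * (X * Y * Z).trace =
      -((S * Z).trace * ((X * X).trace * (Y * Y).trace - (X * Y).trace ^ 2)) := by
  obtain ⟨a, b, c, rfl⟩ := exists_eq_of_trace_eq_zero hX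
  obtain ⟨d, e, f, rfl⟩ := exists_eq_of_trace_eq_zero hY
  obtain ⟨g, h, k, rfl⟩ := exists_eq_of_trace_eq_zero hZ
  obtain ⟨s, t, u, rfl⟩ := exists_eq_of_trace_eq_zero hS
  have key : 2 * (!![a, b; c, -a] * !![d, e; f, -d] * !![s, t; u, -s]).trace *
      (!![a, b; c, -a] * !![d, e; f, -d] * !![g, h; k, -g]).trace =
      -((!![s, t; u, -s] * !![g, h; k, -g]).trace * ((!![a, b; c, -a] * !![a, b; c, -a]).trace *
        (!![d, e; f, -d] * !![d, e; f, -d]).trace - (!![a, b; c, -a] * !![d, e; f, -d]).trace ^ 2)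
      + (!![s, t; u, -s] * !![a, b; c, -a]).trace * (
        (!![a, b; c, -a] * !![d, e; f, -d]).trace * (!![d, e; f, -d] * !![g, h; k, -g]).trace
        - (!![d, e; f, -d] * !![d, e; f, -d]).trace * (!![a, b; c, -a] * !![g, h; k, -g]).trace)
      + (!![s, t; u, -s] * !![d, e; f, -d]).trace * (
        (!![a, b; c, -a] * !![d, e; f, -d]).trace * (!![a, b; c, -a] * !![g, h; k, -g]).trace
        - (!![a, b; c, -a] * !![a, b; c, -a]).trace *
          (!![d, e; f, -d] * !![g, h; k, -g]).trace)) := by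
    simp [Matrix.trace_fin_two]
    ring
  rw [key, hSX, hSY]
  ring

/-- `X`, `Y`, `Z` form a basis and the trace form is nondegenerate. The coefficients in the proof
are the cofactors of Cramer's rule. -/
lemma eq_zero_of_trace_mul_eq_zero {V X Y Z : Matrix (Fin 2) (Fin 2) ℝ} (hV : V.trace = 0)
    (hX : X.trace = 0) (hY : Y.trace = 0) (hZ : Z.trace = 0) (hVX : (V * X).trace = 0)
    (hVY : (V * Y).trace = 0) (hVZ : (V * Z).trace = 0) (hD : (X * Y * Z).trace ≠ 0) : V = 0 := by
  obtain ⟨a, b, c, rfl⟩ := exists_eq_of_trace_eq_zero hX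
  obtain ⟨d, e, f, rfl⟩ := exists_eq_of_trace_eq_zero hY
  obtain ⟨g, h, k, rfl⟩ := exists_eq_of_trace_eq_zero hZ
  obtain ⟨s, t, u, rfl⟩ := exists_eq_of_trace_eq_zero hV
  simp [Matrix.trace_fin_two] at hVX hVY hVZ hD
  have h1 : s = 0 := by
    refine (mul_eq_zero.1 (?_ : _ * s = 0)).resolve_left hD
    linear_combination (e * k - f * h) / 2 * hVX + (c * h - b * k) / 2 * hVY
      + (b * f - c * e) / 2 * hVZ
  have h2 : u = 0 := by
    refine (mul_eq_zero.1 (?_ : _ * u = 0)).resolve_left hD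
    linear_combination (f * g - d * k) * hVX + (a * k - c * g) * hVY
      + (c * d - a * f) * hVZ
  have h3 : t = 0 := by
    refine (mul_eq_zero.1 (?_ : _ * t = 0)).resolve_left hD
    linear_combination (d * h - e * g) * hVX + (b * g - a * h) * hVY
      + (a * e - b * d) * hVZ
  ext i j
  fin_cases i <;> fin_cases j <;> simp [h1, h2, h3]

/-! ### The matrix model of the half-plane -/

/-- The traceless matrix of square `-1` whose Moebius transformation is the half-turn about `z`. -/
noncomputable def halfTurn (z : ℍ) : Matrix (Fin 2) (Fin 2) ℝ :=
  !![z.re / z.im, -((z.re ^ 2 + z.im ^ 2) / z.im); 1 / z.im, -(z.re / z.im)]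

lemma trace_halfTurn (z : ℍ) : (halfTurn z).trace = 0 := by
  simp [halfTurn, Matrix.trace_fin_two]

lemma halfTurn_mul_self (z : ℍ) : halfTurn z * halfTurn z = -1 := by
  have := z.im_ne_zero
  ext i j
  fin_cases i <;> fin_cases j <;> simp [halfTurn] <;> field_simp <;> ring

lemma trace_halfTurn_mul (z w : ℍ) :
    (halfTurn z * halfTurn w).trace = -2 * Real.cosh (dist z w) := by
  have := z.im_ne_zero
  have := w.im_ne_zero
  rw [cosh_dist, Complex.dist_eq, Complex.sq_norm, Complex.normSq_apply]
  simp [halfTurn, Matrix.trace_fin_two]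
  field_simp
  ring

lemma trace_halfTurn_mul_self (z : ℍ) : (halfTurn z * halfTurn z).trace = -2 := by
  rw [trace_halfTurn_mul, dist_self, Real.cosh_zero, mul_one]

lemma halfTurn_injective : Function.Injective halfTurn := by
  intro z w h
  have h1 := congrFun₂ h 1 0
  have h2 := congrFun₂ h 0 0
  simp [halfTurn] at h1 h2
  rw [h1] at h2
  have := w.im_ne_zero
  refine UpperHalfPlane.ext_re_im ?_ h1
  field_simp at h2
  exact h2

lemma trace_halfTurn_mul_eq_iff {z w z' w' : ℍ} :
    (halfTurn z * halfTurn w).trace = (halfTurn z' * halfTurn w').trace ↔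
      dist z w = dist z' w' := by
  rw [trace_halfTurn_mul, trace_halfTurn_mul]
  constructor
  · intro h
    exact Real.cosh_strictMonoOn.injOn dist_nonneg dist_nonneg (by linarith)
  · intro h
    rw [h]

/-- The traceless matrices of square `-1` form a two-sheeted hyperboloid. A negative product with
one point of the sheet of half-turns places `X` on that sheet, which is the condition that its lower
left entry is positive. -/
lemma exists_halfTurn_eq {X : Matrix (Fin 2) (Fin 2) ℝ} (hX : X.trace = 0) (hX2 : X * X = -1)
    {z : ℍ} (hz : (X * halfTurn z).trace < 0) : ∃ w, halfTurn w = X := by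
  obtain ⟨a, b, c, rfl⟩ := exists_eq_of_trace_eq_zero hX
  have h1 := congrFun₂ hX2 0 0
  simp at h1
  have hzi := z.im_pos
  have hc : 0 < c := by
    by_contra hc
    push Not at hc
    have hb : c * b ≤ -1 := by nlinarith
    have hc' : c < 0 := by
      rcases hc.lt_or_eq with h | h
      · exact h
      · rw [h] at hb; linarith
    have : 0 ≤ (!![a, b; c, -a] * halfTurn z).trace := by
      have e : (!![a, b; c, -a] * halfTurn z).trace =
          -((c * z.re - a) ^ 2 + (c * z.im) ^ 2 + 1) / (c * z.im) := by
        have := z.im_ne_zero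
        have := hc'.ne
        simp [halfTurn, Matrix.trace_fin_two]
        field_simp
        linear_combination h1
      rw [e]
      exact div_nonneg_of_nonpos (by nlinarith [sq_nonneg (c * z.re - a), sq_nonneg (c * z.im)])
        (by nlinarith)
    linarith
  refine ⟨⟨⟨a / c, 1 / c⟩, by positivity⟩, ?_⟩
  ext i j
  fin_cases i <;> fin_cases j <;> simp [halfTurn, UpperHalfPlane.re, UpperHalfPlane.im] <;>
    field_simp
  linear_combination -h1

lemma halfTurn_smul (g : SL(2, ℝ)) (z : ℍ) :
    halfTurn (g • z) = (g : Matrix (Fin 2) (Fin 2) ℝ) * halfTurn z * (g⁻¹ : SL(2, ℝ)) := by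
  have hd := g.det_coe
  rw [Matrix.det_fin_two] at hd
  have h := coe_specialLinearGroup_apply g z
  have hi := z.im_pos
  have hne : ((g 1 0 : ℝ) * z.re + g 1 1) ^ 2 + ((g 1 0 : ℝ) * z.im) ^ 2 ≠ 0 := by
    intro h0
    have h1 : (g 1 0 : ℝ) * z.im = 0 := by
      nlinarith [sq_nonneg ((g 1 0 : ℝ) * z.re + g 1 1), sq_nonneg ((g 1 0 : ℝ) * z.im)]
    have h2 : (g 1 0 : ℝ) = 0 := by
      rcases mul_eq_zero.1 h1 with h | h
      · exact h
      · exact absurd h hi.ne'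
    have h3 : (g 1 1 : ℝ) = 0 := by
      rw [h2] at h0
      simpa using h0
    rw [h2, h3] at hd
    simp at hd
  have him : (g • z).im = z.im / (((g 1 0 : ℝ) * z.re + g 1 1) ^ 2 + ((g 1 0 : ℝ) * z.im) ^ 2) := by
    rw [← coe_im, h]
    simp [Complex.div_im, Complex.normSq_apply]
    rw [← sub_div, ← sq, ← sq]
    congr 1
    linear_combination z.im * hd
  have hre : (g • z).re =
      ((g 0 0 * z.re + g 0 1) * (g 1 0 * z.re + g 1 1) + g 0 0 * g 1 0 * z.im ^ 2) /
        (((g 1 0 : ℝ) * z.re + g 1 1) ^ 2 + ((g 1 0 : ℝ) * z.im) ^ 2) := by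
    rw [← coe_re, h]
    simp [Complex.div_re, Complex.normSq_apply]
    rw [← add_div, ← sq, ← sq]
    congr 1
    ring
  have hy := z.im_ne_zero
  have e1 : 1 / (g • z).im =
      ((g 1 0 * z.re + g 1 1) ^ 2 + (g 1 0 * z.im) ^ 2) / z.im := by
    rw [him, one_div_div]
  have e2 : (g • z).re / (g • z).im =
      ((g 0 0 * z.re + g 0 1) * (g 1 0 * z.re + g 1 1) + g 0 0 * g 1 0 * z.im ^ 2) / z.im := by
    rw [him, hre, div_div_div_cancel_right₀ hne]
  -- Multiplicativity of the norm for `(a z + b)` times the conjugate of `c z + d`: the imaginary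
  -- part of this product is `z.im` because the determinant is `1`.
  have key : ((g 0 0 * z.re + g 0 1) * (g 1 0 * z.re + g 1 1) + g 0 0 * g 1 0 * z.im ^ 2) ^ 2
      + z.im ^ 2 = ((g 1 0 * z.re + g 1 1) ^ 2 + (g 1 0 * z.im) ^ 2) *
        ((g 0 0 * z.re + g 0 1) ^ 2 + (g 0 0 * z.im) ^ 2) := by
    linear_combination -z.im ^ 2 * (g 0 0 * g 1 1 - g 0 1 * g 1 0 + 1) * hd
  have e3 : ((g • z).re ^ 2 + (g • z).im ^ 2) / (g • z).im =
      ((g 0 0 * z.re + g 0 1) ^ 2 + (g 0 0 * z.im) ^ 2) / z.im := by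
    rw [him, hre]
    generalize (g 1 0 * z.re + g 1 1) ^ 2 + (g 1 0 * z.im) ^ 2 = D at *
    rw [div_pow, div_pow, ← add_div, key, div_div_div_eq, div_eq_div_iff (by positivity) hy]
    ring
  rw [Matrix.SpecialLinearGroup.coe_inv, Matrix.adjugate_fin_two]
  simp only [halfTurn, e1, e2, e3]
  ext i j
  fin_cases i <;> fin_cases j <;> simp [Matrix.mul_apply, Fin.sum_univ_two] <;> field_simp <;>
    ring


/-! ### Translation lengths and traces -/

/-- The displacement is split into a constant and a square, so that the infimum can be read off: for
hyperbolic `g` the square vanishes exactly on the axis. -/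
lemma cosh_dist_smul (g : SL(2, ℝ)) (z : ℍ) :
    Real.cosh (dist z (g • z)) = (g : Matrix (Fin 2) (Fin 2) ℝ).trace ^ 2 / 2 - 1 +
      (g 1 0 * (z.re ^ 2 + z.im ^ 2) + (g 1 1 - g 0 0) * z.re - g 0 1) ^ 2 / (2 * z.im ^ 2) := by
  have h := trace_halfTurn_mul z (g • z)
  have hd := g.det_coe
  rw [Matrix.det_fin_two] at hd
  have hy := z.im_ne_zero
  rw [halfTurn_smul, Matrix.SpecialLinearGroup.coe_inv, Matrix.adjugate_fin_two] at h
  have h' : Real.cosh (dist z (g • z)) = -(1 / 2) * (-2 * Real.cosh (dist z (g • z))) := by ring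
  rw [h', ← h]
  simp only [Matrix.trace_fin_two, Matrix.mul_apply, Fin.sum_univ_two]
  simp [halfTurn]
  field_simp
  linear_combination -2 * z.im ^ 2 * hd

lemma exists_axis_point (g : SL(2, ℝ)) (hg : 4 < (g : Matrix (Fin 2) (Fin 2) ℝ).trace ^ 2) :
    ∃ z : ℍ, g 1 0 * (z.re ^ 2 + z.im ^ 2) + (g 1 1 - g 0 0) * z.re - g 0 1 = 0 := by
  have hd := g.det_coe
  rw [Matrix.det_fin_two] at hd
  rw [Matrix.trace_fin_two] at hg
  rcases eq_or_ne (g 1 0 : ℝ) 0 with hc | hc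
  · rw [hc] at hd
    have hne : (g 1 1 : ℝ) - g 0 0 ≠ 0 := by
      intro h0
      have : (g 1 1 : ℝ) = g 0 0 := by linarith
      rw [this] at hg hd
      nlinarith
    refine ⟨⟨⟨g 0 1 / (g 1 1 - g 0 0), 1⟩, one_pos⟩, ?_⟩
    simp [UpperHalfPlane.re, UpperHalfPlane.im, hc]
    field_simp
    ring
  · have hs : 0 < (g 0 0 + g 1 1 : ℝ) ^ 2 - 4 := by linarith
    -- The top of the semicircle whose endpoints are the two real fixed points of `g`.
    refine ⟨⟨⟨(g 0 0 - g 1 1) / (2 * g 1 0), √((g 0 0 + g 1 1) ^ 2 - 4) / (2 * |g 1 0|)⟩, ?_⟩, ?_⟩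
    · have := Real.sqrt_pos.2 hs
      have := abs_pos.2 hc
      positivity
    · simp only [UpperHalfPlane.re, UpperHalfPlane.im]
      rw [div_pow _ (2 * |_|), Real.sq_sqrt hs.le, mul_pow, sq_abs]
      field_simp
      linear_combination 4 * hd

lemma translationLength_eq {γ : ℍ ≃ᵢ ℍ} {g : SL(2, ℝ)} (hγ : ∀ z, γ z = g • z)
    (hg : 4 < (g : Matrix (Fin 2) (Fin 2) ℝ).trace ^ 2) :
    translationLength γ = 2 * Real.arcosh (|(g : Matrix (Fin 2) (Fin 2) ℝ).trace| / 2) := by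
  set t := (g : Matrix (Fin 2) (Fin 2) ℝ).trace with ht
  have h1 : 1 ≤ |t| / 2 := by
    rw [← sq_abs] at hg
    nlinarith [abs_nonneg t]
  have h0 : 0 ≤ 2 * Real.arcosh (|t| / 2) := by
    have := Real.arcosh_nonneg h1
    positivity
  have hc : Real.cosh (2 * Real.arcosh (|t| / 2)) = t ^ 2 / 2 - 1 := by
    rw [Real.cosh_two_mul, Real.sinh_sq, Real.cosh_arcosh h1, div_pow, sq_abs]
    ring
  have hb : ∀ z, 2 * Real.arcosh (|t| / 2) ≤ dist z (γ z) := by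
    intro z
    rw [← Real.cosh_strictMonoOn.le_iff_le h0 dist_nonneg, hc, hγ,
      cosh_dist_smul]
    exact le_add_of_nonneg_right (by positivity)
  obtain ⟨z, hz⟩ := exists_axis_point g hg
  apply le_antisymm
  · refine (ciInf_le ⟨0, ?_⟩ z).trans ?_
    · rintro _ ⟨w, rfl⟩
      exact dist_nonneg
    · rw [← Real.cosh_strictMonoOn.le_iff_le dist_nonneg h0, hc, hγ,
        cosh_dist_smul, hz]
      simp [ht]
  · exact le_ciInf hb

lemma eq_one_or_neg_one_of_smul_eq {k : SL(2, ℝ)} (hk : ∀ z : ℍ, k • z = z) :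
    k = 1 ∨ k = -1 := by
  have hcomm : ∀ z, (k : Matrix (Fin 2) (Fin 2) ℝ) * halfTurn z = halfTurn z * k := by
    intro z
    have h := halfTurn_smul k z
    rw [hk] at h
    conv_rhs => rw [h]
    rw [Matrix.mul_assoc, ← Matrix.SpecialLinearGroup.coe_mul, inv_mul_cancel]
    simp
  have hd := k.det_coe
  rw [Matrix.det_fin_two] at hd
  have h1 := hcomm ⟨⟨0, 1⟩, one_pos⟩
  have h2 := hcomm ⟨⟨1, 1⟩, one_pos⟩
  have h100 := congrFun₂ h1 0 0
  have h110 := congrFun₂ h1 1 0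
  have h200 := congrFun₂ h2 0 0
  have h210 := congrFun₂ h2 1 0
  simp [halfTurn, Matrix.mul_apply, Fin.sum_univ_two, UpperHalfPlane.re, UpperHalfPlane.im]
    at h100 h110 h200 h210
  have e1 : (k 1 0 : ℝ) = 0 := by linarith
  have e2 : (k 0 1 : ℝ) = 0 := by linarith
  have e3 : ((k 0 0 : ℝ) - 1) * (k 0 0 + 1) = 0 := by
    rw [e1, h110] at hd
    linear_combination hd
  rcases mul_eq_zero.1 e3 with h | h
  · left
    ext i j
    fin_cases i <;> fin_cases j <;> simp [e1, e2, h110] <;> linarith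
  · right
    ext i j
    fin_cases i <;> fin_cases j <;> simp [e1, e2, h110] <;> linarith

lemma trace_sq_eq_of_smul_eq {g h : SL(2, ℝ)} (hgh : ∀ z : ℍ, g • z = h • z) :
    (g : Matrix (Fin 2) (Fin 2) ℝ).trace ^ 2 = (h : Matrix (Fin 2) (Fin 2) ℝ).trace ^ 2 := by
  rcases eq_one_or_neg_one_of_smul_eq (k := h⁻¹ * g) (fun z => by
    rw [mul_smul, hgh, inv_smul_smul]) with e | e
  · rw [inv_mul_eq_one] at e
    rw [e]
  · rw [inv_mul_eq_iff_eq_mul] at e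
    rw [e]
    simp

lemma isHyperbolic_iff {γ : ℍ ≃ᵢ ℍ} {g : SL(2, ℝ)} (hγ : ∀ z, γ z = g • z) :
    IsHyperbolic γ ↔ 4 < (g : Matrix (Fin 2) (Fin 2) ℝ).trace ^ 2 := by
  constructor
  · rintro ⟨h, hh, hγ'⟩
    rw [trace_sq_eq_of_smul_eq (h := h) fun z => by rw [← hγ, hγ']]
    rw [Matrix.IsHyperbolic, Matrix.discr_fin_two, h.det_coe] at hh
    linarith
  · intro h
    refine ⟨g, ?_, hγ⟩
    rw [Matrix.IsHyperbolic, Matrix.discr_fin_two, g.det_coe]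
    linarith

/-! ### Reflections -/

/-- Since `S` has norm `2`, the right-hand side is the orthogonal reflection in the plane
perpendicular to `S`. -/
lemma mul_mul_eq_sub {S V : Matrix (Fin 2) (Fin 2) ℝ} (hS : S.trace = 0) (hS2 : S * S = 1)
    (hV : V.trace = 0) : -(S * V * S) = V - (S * V).trace • S := by
  have h := mul_add_mul_of_trace_eq_zero hS hV
  have : S * V * S = (S * V).trace • S - V := by
    calc S * V * S = (S * V + V * S) * S - V * (S * S) := by noncomm_ring
      _ = _ := by rw [h, hS2]; simp
  rw [this]
  abel

lemma trace_conj_mul_conj {S V W : Matrix (Fin 2) (Fin 2) ℝ} (hS2 : S * S = 1) :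
    (-(S * V * S) * -(S * W * S)).trace = (V * W).trace := by
  have : -(S * V * S) * -(S * W * S) = S * V * (S * S) * W * S := by noncomm_ring
  rw [this, hS2, mul_one, Matrix.trace_mul_comm, ← mul_assoc, ← mul_assoc, hS2, one_mul]

lemma trace_mul_neg_conj_neg (S : Matrix (Fin 2) (Fin 2) ℝ) (hS : S.trace = 0) (hS2 : S * S = 1)
    (z : ℍ) : (-(S * halfTurn z * S) * halfTurn z).trace < 0 := by
  rw [mul_mul_eq_sub hS hS2 (trace_halfTurn z), sub_mul, Matrix.trace_sub, smul_mul_assoc,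
    Matrix.trace_smul, trace_halfTurn_mul_self, smul_eq_mul]
  nlinarith [mul_self_nonneg (S * halfTurn z).trace]

lemma exists_isometry_halfTurn_eq {S : Matrix (Fin 2) (Fin 2) ℝ} (hS : S.trace = 0)
    (hS2 : S * S = 1) : ∃ σ : ℍ ≃ᵢ ℍ, ∀ z, halfTurn (σ z) = -(S * halfTurn z * S) := by
  have H : ∀ z, ∃ w, halfTurn w = -(S * halfTurn z * S) := by
    intro z
    refine exists_halfTurn_eq ?_ ?_ (trace_mul_neg_conj_neg S hS hS2 z)
    · rw [Matrix.trace_neg, Matrix.trace_mul_comm, ← mul_assoc, hS2, one_mul, trace_halfTurn,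
        neg_zero]
    · have : -(S * halfTurn z * S) * -(S * halfTurn z * S) =
        S * halfTurn z * (S * S) * halfTurn z * S := by noncomm_ring
      rw [this, hS2, mul_one, mul_assoc S, halfTurn_mul_self]
      simp [hS2]
  choose f hf using H
  have hff : ∀ z, f (f z) = z := by
    intro z
    apply halfTurn_injective
    rw [hf, hf]
    have : -(S * -(S * halfTurn z * S) * S) = (S * S) * halfTurn z * (S * S) := by noncomm_ring
    rw [this, hS2, one_mul, mul_one]
  refine ⟨⟨⟨f, f, hff, hff⟩, Isometry.of_dist_eq fun z w => ?_⟩, hf⟩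
  rw [← trace_halfTurn_mul_eq_iff]
  change (halfTurn (f z) * halfTurn (f w)).trace = _
  rw [hf, hf, trace_conj_mul_conj hS2]


/-! ### Lines and reflections in the matrix model -/

lemma trace_triple_sq (x y z : ℍ) :
    (halfTurn x * halfTurn y * halfTurn z).trace ^ 2 =
      4 * (Real.sinh (dist x y) ^ 2 * Real.sinh (dist y z) ^ 2 -
        (Real.cosh (dist x z) - Real.cosh (dist x y) * Real.cosh (dist y z)) ^ 2) := by
  have h := gram_identity (trace_halfTurn x) (trace_halfTurn y) (trace_halfTurn z)
  simp only [trace_halfTurn_mul, dist_self, Real.cosh_zero] at h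
  rw [Real.sinh_sq, Real.sinh_sq]
  rw [dist_comm z x] at h
  linear_combination h / 2

lemma trace_triple_eq_zero_of_dist_add {x y z : ℍ} (h : dist x y + dist y z = dist x z) :
    (halfTurn x * halfTurn y * halfTurn z).trace = 0 := by
  rw [← sq_eq_zero_iff, trace_triple_sq, ← h, Real.cosh_add]
  ring

lemma trace_triple_swap (x y z : ℍ) :
    (halfTurn x * halfTurn z * halfTurn y).trace =
      -(halfTurn x * halfTurn y * halfTurn z).trace := by
  have h := mul_add_mul_of_trace_eq_zero (trace_halfTurn y) (trace_halfTurn z)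
  have : halfTurn x * halfTurn z * halfTurn y = (halfTurn y * halfTurn z).trace • halfTurn x -
      halfTurn x * halfTurn y * halfTurn z := by
    rw [mul_assoc, mul_assoc, eq_sub_iff_add_eq, ← mul_add, add_comm, h]
    simp
  rw [this, Matrix.trace_sub, Matrix.trace_smul, trace_halfTurn]
  simp

lemma trace_triple_rotate (x y z : ℍ) :
    (halfTurn y * halfTurn z * halfTurn x).trace =
      (halfTurn x * halfTurn y * halfTurn z).trace := by
  rw [Matrix.trace_mul_comm, mul_assoc]

lemma segment_comm (z w : ℍ) : segment z w = segment w z := by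
  ext x
  change _ = _ ↔ _ = _
  rw [dist_comm w x, dist_comm x z, dist_comm w z, add_comm]

lemma line_comm (z w : ℍ) : line z w = line w z := by
  ext x
  change _ ∨ _ ∨ _ ↔ _ ∨ _ ∨ _
  rw [segment_comm z w, segment_comm z x, segment_comm x w, or_comm (a := w ∈ _)]

lemma mem_line_iff {z w x : ℍ} :
    x ∈ line z w ↔ (halfTurn z * halfTurn w * halfTurn x).trace = 0 := by
  constructor
  · rintro (h | h | h)
    · rw [← neg_eq_zero, ← trace_triple_swap]
      exact trace_triple_eq_zero_of_dist_add h
    · exact trace_triple_eq_zero_of_dist_add h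
    · rw [trace_triple_rotate]
      exact trace_triple_eq_zero_of_dist_add h
  · intro h
    -- The difference of squares factors into two addition formulas: `cosh (dist z x)` is the `cosh`
    -- of the difference or of the sum of the other two distances.
    rw [← sq_eq_zero_iff, trace_triple_sq, mul_eq_zero, ← mul_pow, sq_sub_sq, mul_eq_zero] at h
    have inj := Real.cosh_strictMonoOn.injOn
    rcases h.resolve_left four_ne_zero with h | h
    · rcases le_total (dist z w) (dist w x) with hle | hle
      · refine Or.inr (Or.inr ?_)
        have e : dist z x = dist w x - dist z w :=
          inj dist_nonneg (sub_nonneg.2 hle) (by rw [Real.cosh_sub]; linarith)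
        change dist x z + dist z w = dist x w
        rw [dist_comm x z, dist_comm x w]
        linarith
      · refine Or.inl ?_
        have e : dist z x = dist z w - dist w x :=
          inj dist_nonneg (sub_nonneg.2 hle) (by rw [Real.cosh_sub]; linarith)
        change dist z x + dist x w = dist z w
        rw [dist_comm x w]
        linarith
    · refine Or.inr (Or.inl ?_)
      have e : dist z x = dist z w + dist w x :=
        inj dist_nonneg (add_nonneg dist_nonneg dist_nonneg) (by rw [Real.cosh_add]; linarith)
      exact e.symm

lemma trace_mul_eq_zero_of_mem_line {z w x : ℍ} (hzw : z ≠ w) {S : Matrix (Fin 2) (Fin 2) ℝ}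
    (hS : S.trace = 0) (hz : (S * halfTurn z).trace = 0) (hw : (S * halfTurn w).trace = 0)
    (hx : x ∈ line z w) : (S * halfTurn x).trace = 0 := by
  rw [mem_line_iff] at hx
  have h := mixed_gram_identity (trace_halfTurn z) (trace_halfTurn w) (trace_halfTurn x) hS hz hw
  rw [hx, mul_zero, eq_comm, neg_eq_zero] at h
  refine (mul_eq_zero.1 h).resolve_right ?_
  rw [trace_halfTurn_mul_self, trace_halfTurn_mul_self, trace_halfTurn_mul]
  have := Real.one_lt_cosh.2 (dist_pos.2 hzw).ne'
  nlinarith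

lemma mem_line_left (z w : ℍ) : z ∈ line z w := Or.inl (by simp [segment])

lemma mem_line_right (z w : ℍ) : w ∈ line z w := Or.inl (by simp [segment])

/-- The difference of the two matrices is orthogonal to `z` and `w`, hence a multiple `t • S`.
Equality of norms gives a quadratic equation for `t`, whose roots correspond to the point itself and
its mirror image. -/
lemma halfTurn_eq_or_eq_sub_of_dist_eq {z w x y : ℍ} (hzw : z ≠ w)
    {S : Matrix (Fin 2) (Fin 2) ℝ} (hS : S.trace = 0) (hS2 : S * S = 1)
    (hz : (S * halfTurn z).trace = 0) (hw : (S * halfTurn w).trace = 0)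
    (h1 : dist x z = dist y z) (h2 : dist x w = dist y w) :
    halfTurn y = halfTurn x ∨ halfTurn y = halfTurn x - (S * halfTurn x).trace • S := by
  have hc := Real.one_lt_cosh.2 (dist_pos.2 hzw).ne'
  have hSS : (S * S).trace = 2 := by rw [hS2]; simp
  have hD : (halfTurn z * halfTurn w * S).trace ≠ 0 := by
    intro h0
    have h := mixed_gram_identity (trace_halfTurn z) (trace_halfTurn w) hS hS hz hw
    rw [h0, hSS, trace_halfTurn_mul_self, trace_halfTurn_mul_self, trace_halfTurn_mul] at h
    nlinarith
  rw [← trace_halfTurn_mul_eq_iff] at h1 h2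
  have hVt : (halfTurn x).trace = 0 := trace_halfTurn x
  have hVt' : (halfTurn y).trace = 0 := trace_halfTurn y
  have e1 : (halfTurn y * halfTurn y).trace = -2 := trace_halfTurn_mul_self _
  have e2 : (halfTurn x * halfTurn x).trace = -2 := trace_halfTurn_mul_self _
  generalize halfTurn x = V at *
  generalize halfTurn y = V' at *
  set t := ((V - V') * S).trace / 2 with ht
  have h0 : V - V' - t • S = 0 := by
    refine eq_zero_of_trace_mul_eq_zero ?_ (trace_halfTurn z) (trace_halfTurn w) hS ?_ ?_ ?_ hD
    · simp [Matrix.trace_sub, hVt, hVt', hS]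
    · simp [sub_mul, h1, hz]
    · simp [sub_mul, h2, hw]
    · rw [sub_mul _ (t • S), Matrix.trace_sub, smul_mul_assoc, Matrix.trace_smul, hSS, ht]
      simp
  have h1 : V' = V - t • S := by
    rw [sub_sub, sub_eq_zero] at h0
    rw [h0]
    abel
  have h2 : t * (t - (S * V).trace) = 0 := by
    rw [h1] at e1
    simp only [sub_mul, mul_sub, smul_mul_assoc, mul_smul_comm, Matrix.trace_sub,
      Matrix.trace_smul, hSS, e2, Matrix.trace_mul_comm V S, smul_eq_mul] at e1
    linarith
  rcases mul_eq_zero.1 h2 with h | h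
  · left
    rw [h1, h]
    simp
  · right
    rw [h1, sub_eq_zero.1 h]

/-- An isometry that fixes the line sends each point to itself or to its mirror image. Once one
point `x₀` is moved, every point off the line is moved, as its distances to `x₀` and to the mirror
image of `x₀` differ. -/
lemma isReflection_iff {z w : ℍ} (hzw : z ≠ w) {S : Matrix (Fin 2) (Fin 2) ℝ}
    (hS : S.trace = 0) (hS2 : S * S = 1) (hz : (S * halfTurn z).trace = 0)
    (hw : (S * halfTurn w).trace = 0) {y : ℍ} (hy : (S * halfTurn y).trace ≠ 0) {σ : ℍ ≃ᵢ ℍ} :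
    IsReflection z w σ ↔ ∀ x, halfTurn (σ x) = -(S * halfTurn x * S) := by
  have hSS : (S * S).trace = 2 := by rw [hS2]; simp
  constructor
  · rintro ⟨h1, hfix⟩
    have key : ∀ x, halfTurn (σ x) = halfTurn x ∨
        halfTurn (σ x) = halfTurn x - (S * halfTurn x).trace • S := by
      intro x
      have hd : ∀ u ∈ line z w, dist x u = dist (σ x) u := by
        intro u hu
        conv_rhs => rw [← hfix u hu]
        exact (σ.dist_eq x u).symm
      exact halfTurn_eq_or_eq_sub_of_dist_eq hzw hS hS2 hz hw (hd z (mem_line_left z w))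
        (hd w (mem_line_right z w))
    obtain ⟨x₀, hx₀⟩ : ∃ x, σ x ≠ x := by
      by_contra hcon
      push Not at hcon
      exact h1 (IsometryEquiv.ext hcon)
    have hx₀' := (key x₀).resolve_left fun h => hx₀ (halfTurn_injective h)
    have ht₀ : (S * halfTurn x₀).trace ≠ 0 := by
      intro h
      rw [h, zero_smul, sub_zero] at hx₀'
      exact hx₀ (halfTurn_injective hx₀')
    intro x
    rw [mul_mul_eq_sub hS hS2 (trace_halfTurn x)]
    rcases key x with h | h
    · have e := trace_halfTurn_mul_eq_iff.2 (σ.dist_eq x₀ x)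
      rw [h, hx₀', sub_mul, Matrix.trace_sub, smul_mul_assoc, Matrix.trace_smul, smul_eq_mul,
        sub_eq_self] at e
      rw [h, (mul_eq_zero.1 e).resolve_left ht₀, zero_smul, sub_zero]
    · exact h
  · intro h
    refine ⟨?_, fun x hx => halfTurn_injective ?_⟩
    · rintro rfl
      have := h y
      rw [mul_mul_eq_sub hS hS2 (trace_halfTurn y)] at this
      change halfTurn y = _ at this
      rw [eq_comm, sub_eq_self, smul_eq_zero] at this
      rcases this with h | h
      · exact hy h
      · rw [h] at hSS
        simp at hSS
    · rw [h, mul_mul_eq_sub hS hS2 (trace_halfTurn x),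
        trace_mul_eq_zero_of_mem_line hzw hS hz hw hx, zero_smul, sub_zero]

/-! ### Angles -/

lemma cayley_re_im (z w : ℍ) :
    cayley z w = ⟨((w.re - z.re) ^ 2 + w.im ^ 2 - z.im ^ 2) /
        ((w.re - z.re) ^ 2 + (w.im + z.im) ^ 2),
      (-2 * z.im * (w.re - z.re)) / ((w.re - z.re) ^ 2 + (w.im + z.im) ^ 2)⟩ := by
  have h : (w.re - z.re) ^ 2 + (w.im + z.im) ^ 2 ≠ 0 := by
    have := z.im_pos
    have := w.im_pos
    positivity
  apply Complex.ext
  · simp only [cayley, Complex.div_re, Complex.normSq_apply]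
    simp
    field_simp
    ring
  · simp only [cayley, Complex.div_im, Complex.normSq_apply]
    simp
    field_simp
    ring

/-- The law of cosines before normalization; `norm_cayley` shows that the Cayley vectors have length
`tanh (d / 2)`. -/
lemma cosh_dist_cayley (z w₁ w₂ : ℍ) :
    2 * Real.cosh (dist w₁ z) * Real.cosh (dist z w₂) - 2 * Real.cosh (dist w₁ w₂) =
      2 * (Real.cosh (dist w₁ z) + 1) * (Real.cosh (dist z w₂) + 1) *
        inner ℝ (cayley z w₁) (cayley z w₂) := by
  rw [cayley_re_im, cayley_re_im, cosh_dist', cosh_dist', cosh_dist', Complex.inner]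
  have := z.im_pos
  have := w₁.im_pos
  have := w₂.im_pos
  simp
  have h : (w₁.re - z.re) ^ 2 + (w₁.im + z.im) ^ 2 ≠ 0 := by positivity
  have h' : (w₂.re - z.re) ^ 2 + (w₂.im + z.im) ^ 2 ≠ 0 := by positivity
  field_simp
  ring

lemma norm_cayley (z w : ℍ) :
    (Real.cosh (dist z w) + 1) * ‖cayley z w‖ = Real.sinh (dist z w) := by
  have h := cosh_dist_cayley z w w
  rw [dist_self, Real.cosh_zero, real_inner_self_eq_norm_sq, dist_comm w z] at h
  refine (sq_eq_sq₀ ?_ ?_).1 ?_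
  · have := Real.one_le_cosh (dist z w)
    positivity
  · exact Real.sinh_nonneg_iff.2 dist_nonneg
  · rw [Real.sinh_sq, mul_pow]
    linarith

/-- The hyperbolic law of cosines. -/
lemma cosh_dist_eq_of_angle (w₁ z w₂ : ℍ) :
    Real.cosh (dist w₁ w₂) = Real.cosh (dist w₁ z) * Real.cosh (dist z w₂) -
      Real.sinh (dist w₁ z) * Real.sinh (dist z w₂) * Real.cos (angle w₁ z w₂) := by
  have h := cosh_dist_cayley z w₁ w₂
  rw [dist_comm w₁ z] at *
  rw [← norm_cayley z w₁, ← norm_cayley z w₂]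
  have h2 := InnerProductGeometry.cos_angle_mul_norm_mul_norm (cayley z w₁) (cayley z w₂)
  rw [angle]
  rw [← h2] at h
  linarith


/-! ### Unit normals of lines -/

/-- The unit normal of the line through `z` and `w`. -/
noncomputable def unitNormal (z w : ℍ) : Matrix (Fin 2) (Fin 2) ℝ :=
  (Real.sinh (dist z w))⁻¹ • (halfTurn z * halfTurn w + Real.cosh (dist z w) • 1)

lemma trace_unitNormal (z w : ℍ) : (unitNormal z w).trace = 0 := by
  simp [unitNormal, trace_halfTurn_mul]
  ring

lemma trace_unitNormal_mul (z w x : ℍ) : (unitNormal z w * halfTurn x).trace =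
    (Real.sinh (dist z w))⁻¹ * (halfTurn z * halfTurn w * halfTurn x).trace := by
  simp [unitNormal, add_mul, trace_halfTurn]

lemma trace_unitNormal_mul_left (z w : ℍ) : (unitNormal z w * halfTurn z).trace = 0 := by
  rw [trace_unitNormal_mul, Matrix.trace_mul_comm, ← mul_assoc, halfTurn_mul_self, neg_one_mul,
    Matrix.trace_neg, trace_halfTurn]
  simp

lemma trace_unitNormal_mul_right (z w : ℍ) : (unitNormal z w * halfTurn w).trace = 0 := by
  rw [trace_unitNormal_mul, mul_assoc, halfTurn_mul_self, mul_neg_one, Matrix.trace_neg,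
    trace_halfTurn]
  simp

/-- Both normals are oriented by traversing `z`, `w`, `x` in the same sense, so that their angle is
the exterior one; hence the minus sign. -/
lemma trace_unitNormal_mul_unitNormal {z w x : ℍ} (hzw : z ≠ w) (hwx : w ≠ x) :
    (unitNormal z w * unitNormal w x).trace = -2 * Real.cos (angle z w x) := by
  have h1 := (Real.sinh_pos_iff.2 (dist_pos.2 hzw)).ne'
  have h2 := (Real.sinh_pos_iff.2 (dist_pos.2 hwx)).ne'
  have hc := cosh_dist_eq_of_angle z w x
  have e : ((halfTurn z * halfTurn w + Real.cosh (dist z w) • 1) *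
      (halfTurn w * halfTurn x + Real.cosh (dist w x) • 1)).trace =
      2 * Real.cosh (dist z x) - 2 * Real.cosh (dist z w) * Real.cosh (dist w x) := by
    have : halfTurn z * halfTurn w * (halfTurn w * halfTurn x) = -(halfTurn z * halfTurn x) := by
      rw [mul_assoc, ← mul_assoc (halfTurn w), halfTurn_mul_self]
      simp
    simp only [add_mul, mul_add, this, Matrix.trace_add, Matrix.trace_neg, trace_halfTurn_mul,
      smul_mul_assoc, mul_smul_comm, one_mul, mul_one, Matrix.trace_smul, smul_eq_mul,
      Matrix.trace_one, Fintype.card_fin]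
    push_cast
    ring
  rw [unitNormal, unitNormal, smul_mul_smul_comm, Matrix.trace_smul, e, hc, smul_eq_mul]
  field_simp
  ring

lemma unitNormal_mul_self {z w : ℍ} (hzw : z ≠ w) : unitNormal z w * unitNormal z w = 1 := by
  have h1 := (Real.sinh_pos_iff.2 (dist_pos.2 hzw)).ne'
  have e : (halfTurn z * halfTurn w + Real.cosh (dist z w) • 1) *
      (halfTurn z * halfTurn w + Real.cosh (dist z w) • 1) =
      (Real.sinh (dist z w) * Real.sinh (dist z w)) • 1 := by
    have h := mul_add_mul_of_trace_eq_zero (trace_halfTurn z) (trace_halfTurn w)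
    have h' : halfTurn z * halfTurn w * (halfTurn z * halfTurn w) =
        (-2 * Real.cosh (dist z w)) • (halfTurn z * halfTurn w) - 1 := by
      have h2 := eq_sub_iff_add_eq.2 ((add_comm _ _).trans h)
      rw [trace_halfTurn_mul] at h2
      calc _ = halfTurn z * (halfTurn w * halfTurn z) * halfTurn w := by noncomm_ring
        _ = (-2 * Real.cosh (dist z w)) • (halfTurn z * halfTurn w) -
            (halfTurn z * halfTurn z) * (halfTurn w * halfTurn w) := by
          rw [h2, mul_sub, sub_mul, mul_smul_comm, smul_mul_assoc, mul_one]
          noncomm_ring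
        _ = _ := by simp [halfTurn_mul_self]
    rw [← sq (Real.sinh _), Real.sinh_sq]
    simp only [add_mul, mul_add, h', smul_mul_assoc, mul_smul_comm, one_mul, mul_one]
    module
  rw [unitNormal, smul_mul_smul_comm, e, smul_smul]
  field_simp
  simp

lemma trace_triple_unitNormal_ne_zero {z w : ℍ} (hzw : z ≠ w) :
    (halfTurn z * halfTurn w * unitNormal z w).trace ≠ 0 := by
  intro h0
  have hS := trace_unitNormal z w
  have hc := Real.one_lt_cosh.2 (dist_pos.2 hzw).ne'
  have h := mixed_gram_identity (trace_halfTurn z) (trace_halfTurn w) hS hS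
    (trace_unitNormal_mul_left z w) (trace_unitNormal_mul_right z w)
  rw [h0, unitNormal_mul_self hzw, trace_halfTurn_mul_self, trace_halfTurn_mul_self,
    trace_halfTurn_mul] at h
  simp at h
  nlinarith

/-- Both sides have the same products with the basis `halfTurn z`, `halfTurn w`, `unitNormal z w`;
the first two comparisons are addition formulas. -/
lemma sinh_smul_halfTurn_of_mem_segment {z w x : ℍ} (hzw : z ≠ w) (hx : x ∈ segment z w) :
    Real.sinh (dist z w) • halfTurn x =
      Real.sinh (dist x w) • halfTurn z + Real.sinh (dist z x) • halfTurn w := by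
  have hd : dist z w = dist z x + dist x w := Eq.symm hx
  have hl : x ∈ line z w := Or.inl hx
  rw [← sub_eq_zero]
  refine eq_zero_of_trace_mul_eq_zero ?_ (trace_halfTurn z) (trace_halfTurn w)
    (trace_unitNormal z w) ?_ ?_ ?_ (trace_triple_unitNormal_ne_zero hzw)
  · simp [trace_halfTurn]
  · simp only [sub_mul, add_mul, smul_mul_assoc, Matrix.trace_sub, Matrix.trace_add,
      Matrix.trace_smul, trace_halfTurn_mul, smul_eq_mul, dist_self, Real.cosh_zero]
    rw [dist_comm w z, dist_comm x z, hd, Real.sinh_add, Real.cosh_add]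
    linear_combination -2 * Real.sinh (dist x w) * Real.cosh_sq_sub_sinh_sq (dist z x)
  · simp only [sub_mul, add_mul, smul_mul_assoc, Matrix.trace_sub, Matrix.trace_add,
      Matrix.trace_smul, trace_halfTurn_mul, smul_eq_mul, dist_self, Real.cosh_zero]
    rw [hd, Real.sinh_add, Real.cosh_add]
    linear_combination -2 * Real.sinh (dist z x) * Real.cosh_sq_sub_sinh_sq (dist x w)
  · have hm := trace_mul_eq_zero_of_mem_line hzw (trace_unitNormal z w)
      (trace_unitNormal_mul_left z w) (trace_unitNormal_mul_right z w) hl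
    rw [Matrix.trace_mul_comm]
    simp only [mul_sub, mul_add, mul_smul_comm, Matrix.trace_sub, Matrix.trace_add,
      Matrix.trace_smul, hm, trace_unitNormal_mul_left, trace_unitNormal_mul_right]
    simp

/-! ### Tangent circles -/

/-- The conclusion is the hyperbolic Pythagorean theorem: the only common point is the foot of the
perpendicular from `c`. Otherwise, reflecting `z` in that foot would give a second common point. -/
lemma trace_of_sphere_inter_line {c z w : ℍ} {ρ : ℝ} (hzw : z ≠ w)
    (h : Metric.sphere c ρ ∩ line z w = {z}) :
    -2 * (halfTurn c * halfTurn w).trace =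
      (halfTurn c * halfTurn z).trace * (halfTurn z * halfTurn w).trace := by
  set S := unitNormal z w with hSdef
  have hS : S.trace = 0 := trace_unitNormal z w
  have hS2 : S * S = 1 := unitNormal_mul_self hzw
  have hSS : (S * S).trace = 2 := by rw [hS2]; simp
  have hSz : (S * halfTurn z).trace = 0 := trace_unitNormal_mul_left z w
  have hSw : (S * halfTurn w).trace = 0 := trace_unitNormal_mul_right z w
  set s := (S * halfTurn c).trace / 2 with hs
  have hSc : (S * halfTurn c).trace = 2 * s := by rw [hs]; ring
  -- `P` is the orthogonal projection of the centre to the plane of the line, a multiple of the foot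
  -- of the perpendicular; `Z` below is the mirror image of `z` in it.
  set P := halfTurn c - s • S with hP
  have hPt : P.trace = 0 := by simp [hP, hS, trace_halfTurn]
  have hSP : (S * P).trace = 0 := by
    simp [hP, mul_sub, hSS, hSc]
    ring
  have hPx : ∀ x, (S * halfTurn x).trace = 0 →
      (P * halfTurn x).trace = (halfTurn c * halfTurn x).trace := by
    intro x hx
    simp [hP, sub_mul, hx]
  have hPc : (P * halfTurn c).trace = -2 - 2 * s ^ 2 := by
    simp only [hP, sub_mul, smul_mul_assoc, Matrix.trace_sub, Matrix.trace_smul, hSc,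
      trace_halfTurn_mul_self, smul_eq_mul]
    ring
  have hPP : (P * P).trace = -2 - 2 * s ^ 2 := by
    rw [← hPc]
    conv_lhs => arg 1; arg 2; rw [hP]
    rw [mul_sub, Matrix.trace_sub, mul_smul_comm, Matrix.trace_smul, Matrix.trace_mul_comm P S, hSP]
    simp
  have hPP0 : (P * P).trace ≠ 0 := by
    rw [hPP]
    nlinarith [sq_nonneg s]
  set k := (P * halfTurn z).trace / (P * P).trace with hk
  have hkP : (P * halfTurn z).trace = k * (P * P).trace := by
    rw [hk]
    field_simp
  set Z := (2 * k) • P - halfTurn z with hZ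
  have hZt : Z.trace = 0 := by simp [hZ, hPt, trace_halfTurn]
  have hZZ : Z * Z = -1 := by
    rw [mul_self_of_trace_eq_zero hZt]
    have : (Z * Z).trace = -2 := by
      simp only [hZ, sub_mul, mul_sub, smul_mul_assoc, mul_smul_comm, Matrix.trace_sub,
        Matrix.trace_smul, smul_eq_mul, Matrix.trace_mul_comm (halfTurn z) P, hkP,
        trace_halfTurn_mul_self]
      ring
    rw [this]
    simp
  have hZc : (Z * halfTurn c).trace = (halfTurn z * halfTurn c).trace := by
    have h1 : (Z * halfTurn c).trace =
        2 * (k * (P * P).trace) - (halfTurn z * halfTurn c).trace := by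
      simp only [hZ, sub_mul, smul_mul_assoc, Matrix.trace_sub, Matrix.trace_smul, smul_eq_mul,
        hPc, hPP]
      ring
    rw [h1, ← hkP, hPx z hSz, Matrix.trace_mul_comm (halfTurn c)]
    ring
  obtain ⟨u, hu⟩ := exists_halfTurn_eq hZt hZZ (z := c) (by
    rw [hZc, trace_halfTurn_mul]
    have := Real.cosh_pos (dist z c)
    linarith)
  have huz : u = z := by
    have hmem : u ∈ Metric.sphere c ρ ∩ line z w := by
      have hz : z ∈ Metric.sphere c ρ ∩ line z w := by rw [h]; rfl
      refine ⟨?_, ?_⟩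
      · rw [← hu, trace_halfTurn_mul_eq_iff] at hZc
        rw [Metric.mem_sphere, hZc]
        exact hz.1
      · rw [mem_line_iff, hu, hZ, mul_sub, Matrix.trace_sub, mul_smul_comm, Matrix.trace_smul]
        have h1 := mixed_gram_identity (trace_halfTurn z) (trace_halfTurn w) hPt hS hSz hSw
        rw [hSP, zero_mul, neg_zero] at h1
        have h2 : (halfTurn z * halfTurn w * P).trace = 0 :=
          (mul_eq_zero.1 h1).resolve_left (mul_ne_zero two_ne_zero
            (trace_triple_unitNormal_ne_zero hzw))
        have h3 := mem_line_iff.1 hz.2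
        rw [h2, h3]
        simp
    rw [h] at hmem
    exact hmem
  rw [huz] at hu
  have hzP : halfTurn z = k • P := by
    have : (2 : ℝ) • halfTurn z = (2 : ℝ) • (k • P) := by
      rw [two_smul, smul_smul]
      nth_rewrite 1 [hu]
      rw [hZ]
      abel
    exact smul_right_injective _ two_ne_zero this
  rw [← hPx z hSz, ← hPx w hSw]
  have h1 : (halfTurn z * halfTurn w).trace = k * (P * halfTurn w).trace := by
    rw [hzP]
    simp
  have h2 : k * (P * halfTurn z).trace = -2 := by
    rw [← trace_halfTurn_mul_self z]
    nth_rewrite 2 [hzP]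
    simp
  rw [h1, ← h2]
  ring

/-- The radius to `z` would be perpendicular to two distinct lines. In matrices, the component of
the centre orthogonal to `halfTurn z` is orthogonal to a basis, so the centre is `z` and the radius
vanishes. -/
lemma false_of_tangent {c z w x : ℍ} {ρ : ℝ} (hρ : 0 < ρ) (hzw : z ≠ w) (hzx : z ≠ x)
    (hD : (halfTurn z * halfTurn w * halfTurn x).trace ≠ 0)
    (h1 : Metric.sphere c ρ ∩ line z w = {z}) (h2 : Metric.sphere c ρ ∩ line z x = {z}) :
    False := by
  have hcz : dist z c = ρ := by
    have : z ∈ Metric.sphere c ρ ∩ line z w := by rw [h1]; rfl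
    exact this.1
  have e1 := trace_of_sphere_inter_line hzw h1
  have e2 := trace_of_sphere_inter_line hzx h2
  have hV : halfTurn c + ((halfTurn c * halfTurn z).trace / 2) • halfTurn z = 0 := by
    refine eq_zero_of_trace_mul_eq_zero ?_ (trace_halfTurn z) (trace_halfTurn w)
      (trace_halfTurn x) ?_ ?_ ?_ hD
    · simp [trace_halfTurn]
    all_goals
      simp only [add_mul, smul_mul_assoc, Matrix.trace_add, Matrix.trace_smul, smul_eq_mul,
        trace_halfTurn_mul_self]
      linarith
  have h3 : ((halfTurn c + ((halfTurn c * halfTurn z).trace / 2) • halfTurn z)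
      * halfTurn c).trace = 0 := by
    rw [hV]
    simp
  simp only [add_mul, smul_mul_assoc, Matrix.trace_add, Matrix.trace_smul, smul_eq_mul,
    trace_halfTurn_mul, dist_self, Real.cosh_zero, dist_comm c z, hcz] at h3
  have := Real.one_lt_cosh.2 hρ.ne'
  nlinarith

lemma IsContactPoint.ne {A B C Q : ℍ} (hQ : IsContactPoint A B C Q) (hAB : A ≠ B) (hBC : B ≠ C)
    (hCA : C ≠ A) (hD : (halfTurn A * halfTurn B * halfTurn C).trace ≠ 0) :
    A ≠ Q ∧ Q ≠ B := by
  obtain ⟨I, ρ, P, R, hρ, -, -, -, hQt, hPt, hRt⟩ := hQ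
  constructor
  · rintro rfl
    have hA : A ∈ Metric.sphere I ρ ∩ line C A := by
      refine ⟨?_, Or.inl (by simp [segment])⟩
      have : A ∈ Metric.sphere I ρ ∩ line A B := by rw [hQt]; rfl
      exact this.1
    rw [TouchesAt] at hRt hQt
    have hR : A = R := by rw [hRt] at hA; exact hA
    rw [← hR, line_comm] at hRt
    exact false_of_tangent hρ hAB hCA.symm hD hQt hRt
  · rintro rfl
    have hA : Q ∈ Metric.sphere I ρ ∩ line Q C := by
      refine ⟨?_, Or.inl (by simp [segment])⟩
      have : Q ∈ Metric.sphere I ρ ∩ line A Q := by rw [hQt]; rfl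
      exact this.1
    rw [TouchesAt] at hPt hQt
    have hP : Q = P := by rw [hPt] at hA; exact hA
    rw [← hP] at hPt
    rw [line_comm] at hQt
    refine false_of_tangent hρ hBC hAB.symm ?_ hPt hQt
    rwa [trace_triple_rotate]


/-! ### The roots of a triangle -/

/-- `S 0`, `S 1`, `S 2` are the unit normals of the sides `[B, C]`, `[C, A]`, `[A, B]` of a triangle
with angles `π / r`, `π / p`, `π / q`, and `σ 0`, `σ 1`, `σ 2` are the reflections in these sides;
`Q` is an interior point of the side `[A, B]`. -/
structure IsRootSystem (r p q : ℕ) (A B C Q : ℍ) (S : Fin 3 → Matrix (Fin 2) (Fin 2) ℝ)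
    (σ : Fin 3 → ℍ ≃ᵢ ℍ) : Prop where
  trace_eq_zero : ∀ i, (S i).trace = 0
  mul_self : ∀ i, S i * S i = 1
  trace_zero_one : (S 0 * S 1).trace = -2 * Real.cos (Real.pi / q)
  trace_one_two : (S 1 * S 2).trace = -2 * Real.cos (Real.pi / r)
  trace_two_zero : (S 2 * S 0).trace = -2 * Real.cos (Real.pi / p)
  one_A : (S 1 * halfTurn A).trace = 0
  two_A : (S 2 * halfTurn A).trace = 0
  zero_B : (S 0 * halfTurn B).trace = 0
  two_B : (S 2 * halfTurn B).trace = 0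
  zero_Q : (S 0 * halfTurn Q).trace = 2 * Real.sin (Real.pi / p) * Real.sinh (dist B Q)
  one_Q : (S 1 * halfTurn Q).trace = 2 * Real.sin (Real.pi / r) * Real.sinh (dist A Q)
  two_Q : (S 2 * halfTurn Q).trace = 0
  A_ne_Q : A ≠ Q
  B_ne_Q : B ≠ Q
  halfTurn_apply : ∀ i z, halfTurn (σ i z) = -(S i * halfTurn z * S i)
  reflectionGroup_eq : reflectionGroup A B C = Subgroup.closure (Set.range σ)

lemma angle_comm (x y z : ℍ) : angle x y z = angle z y x :=
  InnerProductGeometry.angle_comm _ _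

lemma abs_trace_triple (x y z : ℍ) (h : 0 ≤ Real.sin (angle x y z)) :
    |(halfTurn x * halfTurn y * halfTurn z).trace| =
      2 * Real.sinh (dist x y) * Real.sinh (dist y z) * Real.sin (angle x y z) := by
  have h1 := Real.sinh_nonneg_iff.2 (dist_nonneg (x := x) (y := y))
  have h2 := Real.sinh_nonneg_iff.2 (dist_nonneg (x := y) (y := z))
  rw [← sq_eq_sq₀ (abs_nonneg _) (by positivity), sq_abs, trace_triple_sq,
    cosh_dist_eq_of_angle x y z]
  have := Real.sin_sq (angle x y z)
  rw [mul_pow _ (Real.sin _), this]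
  ring

lemma exists_isRootSystem {r p q : ℕ} (hr : 2 ≤ r) (hp : 2 ≤ p) {A B C Q : ℍ}
    (hT : IsTriangle A B C (Real.pi / r) (Real.pi / p) (Real.pi / q))
    (hQ : IsContactPoint A B C Q) : ∃ S σ, IsRootSystem r p q A B C Q S σ := by
  obtain ⟨hAB, hBC, hCA, hA, hB, hC⟩ := hT
  have hsin : ∀ n : ℕ, 2 ≤ n → 0 < Real.sin (Real.pi / n) := by
    intro n hn
    have hn' : (2 : ℝ) ≤ n := by exact_mod_cast hn
    refine Real.sin_pos_of_pos_of_lt_pi (by positivity) ?_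
    exact div_lt_self Real.pi_pos (by linarith)
  have sAB := Real.sinh_pos_iff.2 (dist_pos.2 hAB)
  have sBC := Real.sinh_pos_iff.2 (dist_pos.2 hBC)
  have sCA := Real.sinh_pos_iff.2 (dist_pos.2 hCA)
  have hA' : angle C A B = Real.pi / r := by rw [angle_comm, hA]
  have hB' : angle A B C = Real.pi / p := by rw [angle_comm, hB]
  have hC' : angle B C A = Real.pi / q := by rw [angle_comm, hC]
  set D := (halfTurn A * halfTurn B * halfTurn C).trace with hDdef
  have hDA : |D| = 2 * Real.sinh (dist C A) * Real.sinh (dist A B) * Real.sin (Real.pi / r) := by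
    rw [hDdef, trace_triple_rotate C A B, ← hA']
    exact abs_trace_triple C A B (by rw [hA']; exact (hsin r hr).le)
  have hDB : |D| = 2 * Real.sinh (dist A B) * Real.sinh (dist B C) * Real.sin (Real.pi / p) := by
    rw [← hB']
    exact abs_trace_triple A B C (by rw [hB']; exact (hsin p hp).le)
  have hD : D ≠ 0 := by
    rw [← abs_pos, hDA]
    have := hsin r hr
    positivity
  -- The common sign `ε` corrects for the orientation of the triangle, so that all three normals
  -- have positive product with the opposite vertex.
  obtain ⟨ε, hε, hεD⟩ : ∃ ε : ℝ, ε * ε = 1 ∧ ε * D = |D| := by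
    rcases le_total 0 D with h | h
    · exact ⟨1, by norm_num, by rw [abs_of_nonneg h, one_mul]⟩
    · exact ⟨-1, by norm_num, by rw [abs_of_nonpos h]; ring⟩
  obtain ⟨hAQ, hQB⟩ := hQ.ne hAB hBC hCA hD
  obtain ⟨-, -, -, -, -, hQs, -⟩ := hQ
  have hQv := sinh_smul_halfTurn_of_mem_segment hAB hQs
  have sq_one : ∀ z w : ℍ, z ≠ w → (ε • unitNormal z w) * (ε • unitNormal z w) = 1 := by
    intro z w hzw
    rw [smul_mul_smul_comm, hε, unitNormal_mul_self hzw, one_smul]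
  have tr_zero : ∀ z w : ℍ, (ε • unitNormal z w).trace = 0 := by
    intro z w
    rw [Matrix.trace_smul, trace_unitNormal, smul_zero]
  have tr_left : ∀ z w : ℍ, (ε • unitNormal z w * halfTurn z).trace = 0 := by
    intro z w
    rw [smul_mul_assoc, Matrix.trace_smul, trace_unitNormal_mul_left, smul_zero]
  have tr_right : ∀ z w : ℍ, (ε • unitNormal z w * halfTurn w).trace = 0 := by
    intro z w
    rw [smul_mul_assoc, Matrix.trace_smul, trace_unitNormal_mul_right, smul_zero]
  have tr_pair : ∀ z w x : ℍ, z ≠ w → w ≠ x → (ε • unitNormal z w * ε • unitNormal w x).trace =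
      -2 * Real.cos (angle z w x) := by
    intro z w x h1 h2
    rw [smul_mul_smul_comm, hε, one_smul, trace_unitNormal_mul_unitNormal h1 h2]
  have tr_opp : ∀ z w x : ℍ, (halfTurn z * halfTurn w * halfTurn x).trace = D →
      (ε • unitNormal z w * halfTurn x).trace = (Real.sinh (dist z w))⁻¹ * |D| := by
    intro z w x h
    rw [smul_mul_assoc, Matrix.trace_smul, trace_unitNormal_mul, h, smul_eq_mul, ← hεD]
    ring
  have oA : (halfTurn B * halfTurn C * halfTurn A).trace = D := by rw [trace_triple_rotate]
  have oB : (halfTurn C * halfTurn A * halfTurn B).trace = D := by rw [trace_triple_rotate, oA]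
  have ne_opp : ∀ z w x : ℍ, z ≠ w → (halfTurn z * halfTurn w * halfTurn x).trace = D →
      (ε • unitNormal z w * halfTurn x).trace ≠ 0 := by
    intro z w x hzw h
    rw [tr_opp z w x h]
    have := (Real.sinh_pos_iff.2 (dist_pos.2 hzw)).ne'
    have := abs_ne_zero.2 hD
    positivity
  obtain ⟨σ₀, hσ₀⟩ := exists_isometry_halfTurn_eq (tr_zero B C) (sq_one B C hBC)
  obtain ⟨σ₁, hσ₁⟩ := exists_isometry_halfTurn_eq (tr_zero C A) (sq_one C A hCA)
  obtain ⟨σ₂, hσ₂⟩ := exists_isometry_halfTurn_eq (tr_zero A B) (sq_one A B hAB)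
  -- Each side has exactly one reflection, so the generating set in `reflectionGroup` is the range
  -- of `σ`.
  have hu : ∀ (z w x : ℍ) (σ' : ℍ ≃ᵢ ℍ), z ≠ w →
      (halfTurn z * halfTurn w * halfTurn x).trace = D →
      (∀ y, halfTurn (σ' y) = -(ε • unitNormal z w * halfTurn y * ε • unitNormal z w)) →
      ∀ τ, IsReflection z w τ ↔ τ = σ' := by
    intro z w x σ' hzw h hσ' τ
    rw [isReflection_iff hzw (tr_zero z w) (sq_one z w hzw) (tr_left z w) (tr_right z w)
      (ne_opp z w x hzw h)]
    constructor
    · intro hτ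
      ext1 y
      apply halfTurn_injective
      rw [hτ, hσ']
    · rintro rfl
      exact hσ'
  have hQS : ∀ S : Matrix (Fin 2) (Fin 2) ℝ, Real.sinh (dist A B) * (S * halfTurn Q).trace =
      Real.sinh (dist Q B) * (S * halfTurn A).trace +
        Real.sinh (dist A Q) * (S * halfTurn B).trace := by
    intro S
    have := congrArg (fun M => (S * M).trace) hQv
    simpa [mul_add] using this
  refine ⟨![ε • unitNormal B C, ε • unitNormal C A, ε • unitNormal A B], ![σ₀, σ₁, σ₂], ?_⟩
  constructor
  · intro i
    fin_cases i <;> exact tr_zero _ _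
  · intro i
    fin_cases i
    exacts [sq_one B C hBC, sq_one C A hCA, sq_one A B hAB]
  · rw [← hC']
    exact tr_pair B C A hBC hCA
  · rw [← hA']
    exact tr_pair C A B hCA hAB
  · rw [← hB']
    exact tr_pair A B C hAB hBC
  · exact tr_right C A
  · exact tr_left A B
  · exact tr_left B C
  · exact tr_right A B
  · apply mul_left_cancel₀ sAB.ne'
    change _ * (ε • unitNormal B C * halfTurn Q).trace = _
    rw [hQS, tr_left B C, tr_opp B C A oA, hDB, dist_comm Q B]
    field_simp
    ring
  · apply mul_left_cancel₀ sAB.ne'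
    change _ * (ε • unitNormal C A * halfTurn Q).trace = _
    rw [hQS, tr_right C A, tr_opp C A B oB, hDA]
    field_simp
    ring
  · apply mul_left_cancel₀ sAB.ne'
    change _ * (ε • unitNormal A B * halfTurn Q).trace = _
    rw [hQS, tr_right A B, tr_left A B]
    ring
  · exact hAQ
  · exact hQB.symm
  · intro i
    fin_cases i
    exacts [hσ₀, hσ₁, hσ₂]
  · rw [reflectionGroup]
    congr 1
    ext τ
    change _ ∨ _ ∨ _ ↔ _
    rw [hu A B C σ₂ hAB rfl hσ₂, hu B C A σ₀ hBC oA hσ₀, hu C A B σ₁ hCA oB hσ₁]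
    simp only [Set.mem_range, Fin.exists_fin_succ, Fin.exists_fin_zero]
    simp [eq_comm]
    tauto


/-! ### Positivity of roots for groups generated by reflections -/

section Roots

variable {ι G V : Type*} [Group G] [AddCommGroup V] [Module ℝ V]

/-- `g` is a product of `n` of the generators `s i`. -/
def HasWord (s : ι → G) (g : G) (n : ℕ) : Prop :=
  ∃ l : List ι, l.length = n ∧ (l.map s).prod = g

/-- `n` is the length of `g` with respect to the generators `s i`. -/
def HasLength (s : ι → G) (g : G) (n : ℕ) : Prop :=
  HasWord s g n ∧ ∀ m, HasWord s g m → n ≤ m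

lemma HasWord.one (s : ι → G) : HasWord s 1 0 := ⟨[], rfl, rfl⟩

lemma HasWord.gen (s : ι → G) (i : ι) : HasWord s (s i) 1 := ⟨[i], rfl, by simp⟩

lemma HasWord.mul {s : ι → G} {g h : G} {m n : ℕ} (hg : HasWord s g m) (hh : HasWord s h n) :
    HasWord s (g * h) (m + n) := by
  obtain ⟨k, rfl, rfl⟩ := hg
  obtain ⟨l, rfl, rfl⟩ := hh
  exact ⟨k ++ l, by simp, by simp⟩

lemma HasWord.exists_last {s : ι → G} {g : G} {n : ℕ} (h : HasWord s g (n + 1)) :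
    ∃ j g', HasWord s g' n ∧ g = g' * s j := by
  obtain ⟨l, hl, rfl⟩ := h
  obtain ⟨l', j, rfl⟩ := List.eq_nil_or_concat' l |>.resolve_left (by rintro rfl; simp at hl)
  exact ⟨j, (l'.map s).prod, ⟨l', by simpa using hl, rfl⟩, by simp⟩

lemma HasWord.eq_one {s : ι → G} {g : G} (h : HasWord s g 0) : g = 1 := by
  obtain ⟨l, hl, rfl⟩ := h
  rw [List.length_eq_zero_iff.1 hl]
  simp

lemma HasWord.exists_hasLength {s : ι → G} {g : G} {n : ℕ} (h : HasWord s g n) :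
    ∃ m, HasLength s g m := by
  classical
  exact ⟨Nat.find ⟨n, h⟩, Nat.find_spec ⟨n, h⟩, fun m hm => Nat.find_min' _ hm⟩

/-- The product of `k` alternating factors `s i` and `s j` that ends in `s j`. -/
def altProd (s : ι → G) : ℕ → ι → ι → G
  | 0, _, _ => 1
  | k + 1, i, j => altProd s k j i * s j

lemma altProd_succ (s : ι → G) (k : ℕ) (i j : ι) :
    altProd s (k + 1) i j = (if Even k then s j else s i) * altProd s k i j := by
  induction k generalizing i j with
  | zero => simp [altProd]
  | succ k ih =>
    rw [altProd, ih, mul_assoc, ← altProd]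
    congr 1
    by_cases h : Even k <;> simp [Nat.even_add_one, h]

lemma HasWord.altProd (s : ι → G) (k : ℕ) (i j : ι) : HasWord s (altProd s k i j) k := by
  induction k generalizing i j with
  | zero => exact HasWord.one s
  | succ k ih => exact (ih j i).mul (HasWord.gen s j)

lemma inv_altProd_mul_altProd {s : ι → G} (hs : ∀ i, s i * s i = 1) (k : ℕ) (i j : ι) :
    (altProd s k j i)⁻¹ * altProd s k i j = (s i * s j) ^ k := by
  have hinv : ∀ i, (s i)⁻¹ = s i := fun i => inv_eq_of_mul_eq_one_left (hs i)
  induction k generalizing i j with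
  | zero => simp [altProd]
  | succ k ih =>
    have h : s i * (s j * s i) ^ k = (s i * s j) ^ k * s i := by
      clear ih
      induction k with
      | zero => simp
      | succ k ih => rw [pow_succ, ← mul_assoc, ih, pow_succ]; simp only [mul_assoc]
    calc _ = s i * ((altProd s k i j)⁻¹ * altProd s k j i) * s j := by
          simp only [altProd, mul_inv_rev, hinv, mul_assoc]
      _ = _ := by rw [ih, h, pow_succ]; simp only [mul_assoc]

/-- For `k = m` the relation of order `m` makes the two alternating products equal, so the word can
be rewritten to end in `s i`, and this letter cancels. Larger `k` only adds letters on the left. -/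
lemma HasWord.altProd_mul {s : ι → G} (hs : ∀ i, s i * s i = 1) {m : ℕ} (hm : m ≠ 0) {i j : ι}
    (hij : (s i * s j) ^ m = 1) {k : ℕ} (hk : m ≤ k) :
    HasWord s (TriangleGroup.altProd s k i j * s i) (k - 1) := by
  induction k, hk using Nat.le_induction with
  | base =>
    have h := inv_altProd_mul_altProd hs m i j
    rw [hij, inv_mul_eq_one] at h
    obtain ⟨m, rfl⟩ := Nat.exists_eq_succ_of_ne_zero hm
    rw [← h, TriangleGroup.altProd, mul_assoc, hs, mul_one]
    exact HasWord.altProd s m i j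
  | succ k hk ih =>
    rw [altProd_succ, mul_assoc, show k + 1 - 1 = 1 + (k - 1) by lia]
    refine HasWord.mul ?_ ih
    split_ifs <;> exact HasWord.gen s _

/-- The cone generated by the vectors `α i`. -/
def posCone [Fintype ι] (α : ι → V) : Set V :=
  {v | ∃ c : ι → ℝ, (∀ i, 0 ≤ c i) ∧ v = ∑ i, c i • α i}

lemma mem_posCone [Fintype ι] (α : ι → V) (i : ι) : α i ∈ posCone α := by
  classical
  refine ⟨Pi.single i 1, fun j => ?_, ?_⟩
  · rw [Pi.single_apply]
    split_ifs <;> simp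
  · simp [Pi.single_apply, ite_smul]

lemma smul_add_smul_mem_posCone [Fintype ι] {α : ι → V} {v w : V} (hv : v ∈ posCone α)
    (hw : w ∈ posCone α) {a b : ℝ} (ha : 0 ≤ a) (hb : 0 ≤ b) : a • v + b • w ∈ posCone α := by
  obtain ⟨c, hc, rfl⟩ := hv
  obtain ⟨d, hd, rfl⟩ := hw
  refine ⟨fun i => a * c i + b * d i, fun i => ?_, ?_⟩
  · have := hc i
    have := hd i
    positivity
  · simp only [Finset.smul_sum, smul_smul, add_smul, Finset.sum_add_distrib]

/-- The reflections `s i` generate a geometric representation of a Coxeter group, with simple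
roots `α i`: the product of two of them has a finite order `m`, and the roots form the
angle `π - π / m`. -/
structure IsCoxeterRepresentation (s : ι → V ≃ₗ[ℝ] V) (α : ι → V) : Prop where
  mul_self : ∀ i, s i * s i = 1
  apply_self : ∀ i, s i (α i) = -α i
  exists_order : ∀ i j, i ≠ j → ∃ m : ℕ, 2 ≤ m ∧ (s i * s j) ^ m = 1 ∧
    s i (α j) = α j + (2 * Real.cos (Real.pi / m)) • α i ∧
    s j (α i) = α i + (2 * Real.cos (Real.pi / m)) • α j

/-- The orbit of a simple root under a dihedral group. The coefficients satisfy the Chebyshev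
recurrence, and for `θ = π / m` they are nonnegative as long as `k < m`. -/
lemma sin_smul_altProd_apply {s : ι → V ≃ₗ[ℝ] V} {α : ι → V} (hself : ∀ i, s i (α i) = -α i)
    {i j : ι} {θ : ℝ} (hij : s i (α j) = α j + (2 * Real.cos θ) • α i)
    (hji : s j (α i) = α i + (2 * Real.cos θ) • α j) (k : ℕ) :
    Real.sin θ • altProd s k i j (α i) =
      Real.sin ((k + 1) * θ) • (if Even k then α i else α j) +
      Real.sin (k * θ) • (if Even k then α j else α i) := by
  induction k with
  | zero => simp [altProd]
  | succ k ih =>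
    have hrec : Real.sin ((k + 1 + 1) * θ) =
        2 * Real.cos θ * Real.sin ((k + 1) * θ) - Real.sin (k * θ) := by
      rw [show ((k : ℝ) + 1 + 1) * θ = (k + 1) * θ + θ by ring,
        show (k : ℝ) * θ = (k + 1) * θ - θ by ring, Real.sin_add, Real.sin_sub]
      ring
    rw [altProd_succ, LinearEquiv.mul_apply, ← map_smul, ih]
    push_cast
    rw [hrec]
    by_cases h : Even k
    · simp only [h, Nat.even_add_one, not_true, if_true, if_false, map_add, map_smul, hji, hself]
      module
    · simp only [h, Nat.even_add_one, not_false_iff, if_true, if_false, map_add, map_smul, hij,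
        hself]
      module

/-- Induction on the length. If `s j` is the last letter of `g`, split off on the right the longest
alternating product in `s i` and `s j`, without losing length. The remaining `v` is shortened by
neither of the two reflections, so it sends both roots into the cone, and the dihedral formula
expresses `g (α i)` through these images with nonnegative coefficients. -/
theorem IsCoxeterRepresentation.apply_mem_posCone [Fintype ι] {s : ι → V ≃ₗ[ℝ] V} {α : ι → V}
    (h : IsCoxeterRepresentation s α) {n : ℕ} {g : V ≃ₗ[ℝ] V} {i : ι} (hg : HasLength s g n)
    (hgi : ∀ m, HasWord s (g * s i) m → n ≤ m) : g (α i) ∈ posCone α := by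
  induction n using Nat.strong_induction_on generalizing g i with
  | _ n ih =>
  obtain ⟨hw, hmin⟩ := hg
  rcases n with _ | n
  · rw [hw.eq_one]
    exact mem_posCone α i
  obtain ⟨j, g', hg', rfl⟩ := hw.exists_last
  have hij : i ≠ j := by
    rintro rfl
    rw [mul_assoc, h.mul_self, mul_one] at hgi
    exact absurd (hgi n hg') (by lia)
  obtain ⟨m, hm, hord, e1, e2⟩ := h.exists_order i j hij
  set g := g' * s j with hgdef
  let K : Set ℕ := {k | k ≤ n + 1 ∧ ∃ v, HasWord s v (n + 1 - k) ∧ g = v * altProd s k i j}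
  have hK1 : 1 ∈ K := ⟨by lia, g', hg', by simp [altProd, hgdef]⟩
  have hKb : BddAbove K := ⟨n + 1, fun k hk => hk.1⟩
  obtain ⟨hkn, v, hv, hgv⟩ : sSup K ∈ K := Nat.sSup_mem ⟨1, hK1⟩ hKb
  have hk1 : 1 ≤ sSup K := le_csSup hKb hK1
  have hkmax : ∀ k ∈ K, k ≤ sSup K := fun k hk => le_csSup hKb hk
  generalize sSup K = k at *
  have hvmin : ∀ a, HasWord s v a → n + 1 - k ≤ a := by
    intro a ha
    have := hmin _ (hgv ▸ ha.mul (HasWord.altProd s k i j))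
    lia
  -- Maximality of `k`: a shorter word here would extend the alternating product by one letter.
  have hnext : ∀ a, HasWord s (v * (if Even k then s j else s i)) a → n + 1 - k ≤ a := by
    intro a ha
    by_contra hlt
    push Not at hlt
    have e : g = v * (if Even k then s j else s i) * altProd s (k + 1) i j := by
      rw [altProd_succ, hgv, mul_assoc, ← mul_assoc (ite _ _ _) (ite _ _ _)]
      split_ifs <;> simp [h.mul_self]
    have := hmin _ (e ▸ ha.mul (HasWord.altProd s (k + 1) i j))
    have hmem : k + 1 ∈ K := ⟨by lia, _, by rwa [show n + 1 - (k + 1) = a by lia], e⟩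
    have := hkmax _ hmem
    lia
  -- Minimality of the word for `g`: moving one letter of the alternating product back to `v` cannot
  -- shorten `v`.
  have hprev : ∀ a, HasWord s (v * (if Even k then s i else s j)) a → n + 1 - k ≤ a := by
    intro a ha
    obtain ⟨k, rfl⟩ := Nat.exists_eq_succ_of_ne_zero (by lia : k ≠ 0)
    have e : g = v * (if Even (k + 1) then s i else s j) * altProd s k i j := by
      rw [hgv, altProd_succ, mul_assoc]
      by_cases hk : Even k <;> simp [hk, Nat.even_add_one]
    have := hmin _ (e ▸ ha.mul (HasWord.altProd s k i j))
    lia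
  have hvi : v (α i) ∈ posCone α ∧ v (α j) ∈ posCone α := by
    have hl : HasLength s v (n + 1 - k) := ⟨hv, hvmin⟩
    by_cases hk : Even k
    · simp only [hk, if_true] at hnext hprev
      exact ⟨ih _ (by lia) hl hprev, ih _ (by lia) hl hnext⟩
    · simp only [hk, if_false] at hnext hprev
      exact ⟨ih _ (by lia) hl hnext, ih _ (by lia) hl hprev⟩
  -- An alternating product of `m` or more letters could be rewritten to end in `s i`, and then `g *
  -- s i` would be shorter than `g`.
  have hkm : k < m := by
    by_contra hle
    push Not at hle
    have := hv.mul (HasWord.altProd_mul h.mul_self (by lia) hord hle)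
    rw [← mul_assoc, ← hgv] at this
    have := hgi _ this
    lia
  have hm' : (2 : ℝ) ≤ m := by exact_mod_cast hm
  have hkm' : (k : ℝ) + 1 ≤ m := by exact_mod_cast hkm
  have hθ : 0 < Real.sin (Real.pi / m) := by
    refine Real.sin_pos_of_pos_of_lt_pi (by positivity) (div_lt_self Real.pi_pos (by linarith))
  have hsin : ∀ a : ℝ, 0 ≤ a → a ≤ m → 0 ≤ Real.sin (a * (Real.pi / m)) := by
    intro a h0 h1
    refine Real.sin_nonneg_of_nonneg_of_le_pi (by positivity) ?_
    rw [mul_div_assoc', div_le_iff₀ (by linarith), mul_comm]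
    gcongr
  have hs1 := hsin (k + 1) (by positivity) hkm'
  have hs2 := hsin k (by positivity) (by linarith)
  have key := congrArg v (sin_smul_altProd_apply h.apply_self e1 e2 k)
  rw [map_smul, ← LinearEquiv.mul_apply, ← hgv, map_add, map_smul, map_smul] at key
  have : g (α i) = (Real.sin (Real.pi / m))⁻¹ • (Real.sin (Real.pi / m) • g (α i)) := by
    rw [smul_smul, inv_mul_cancel₀ hθ.ne', one_smul]
  rw [this, key, smul_add, smul_smul, smul_smul]
  refine smul_add_smul_mem_posCone ?_ ?_ (by positivity) (by positivity)
  · split_ifs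
    exacts [hvi.1, hvi.2]
  · split_ifs
    exacts [hvi.2, hvi.1]

/-- The stabilizer of an interior point of a wall of the fundamental chamber. -/
theorem IsCoxeterRepresentation.eq_one_or_eq [Fintype ι] {s : ι → V ≃ₗ[ℝ] V} {α : ι → V}
    (h : IsCoxeterRepresentation s α) {i : ι} {f : V →ₗ[ℝ] ℝ} (hi : f (α i) = 0)
    (hj : ∀ j, j ≠ i → 0 < f (α j)) (hαi : α i ≠ 0) (hfi : ∀ v, f (s i v) = f v)
    {g : V ≃ₗ[ℝ] V} {n : ℕ} (hg : HasWord s g n) (hfg : ∀ v, f (g v) = f v) :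
    g = 1 ∨ g = s i := by
  have hnonneg : ∀ j, 0 ≤ f (α j) := fun j => by
    rcases eq_or_ne j i with rfl | hne
    exacts [hi.ge, (hj j hne).le]
  -- If `s j` is the last letter of a shortest word, then `-g (α j)` lies in the cone. As `f` is
  -- nonnegative on the cone and preserved by `g`, it vanishes at `α j`; so `j = i`, and only the
  -- coefficient of `α i` can be nonzero.
  have key : ∀ (g : V ≃ₗ[ℝ] V) (n : ℕ), HasWord s g n → (∀ v, f (g v) = f v) → g ≠ 1 →
      ∃ c : ℝ, 0 ≤ c ∧ g (α i) = -(c • α i) := by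
    intro g n hg hfg hne
    obtain ⟨m, hm, hmin⟩ := hg.exists_hasLength
    rcases m with _ | m
    · exact absurd hm.eq_one hne
    obtain ⟨j, g', hg', rfl⟩ := hm.exists_last
    have hmin' : ∀ a, HasWord s g' a → m ≤ a := fun a ha => by
      have := hmin _ (ha.mul (HasWord.gen s j))
      lia
    obtain ⟨c, hc, hcj⟩ := h.apply_mem_posCone ⟨hg', hmin'⟩ (i := j) fun a ha => by
      have := hmin _ ha
      lia
    have e : (g' * s j) (α j) = -∑ k, c k • α k := by
      rw [LinearEquiv.mul_apply, h.apply_self, map_neg, hcj]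
    have hsum : ∑ k, c k * f (α k) = -f (α j) := by
      rw [← hfg (α j), e]
      simp
    have hterm : ∀ k, 0 ≤ c k * f (α k) := fun k => mul_nonneg (hc k) (hnonneg k)
    have hsum0 : ∑ k, c k * f (α k) = 0 := by
      refine le_antisymm ?_ (Finset.sum_nonneg fun k _ => hterm k)
      rw [hsum]
      linarith [hnonneg j]
    have hji : j = i := by
      by_contra hne
      have := hj j hne
      linarith
    subst hji
    have hz : ∀ k, k ≠ j → c k = 0 := by
      intro k hk
      have := (Finset.sum_eq_zero_iff_of_nonneg fun k _ => hterm k).1 hsum0 k (Finset.mem_univ k)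
      exact (mul_eq_zero.1 this).resolve_right (hj k hk).ne'
    refine ⟨c j, hc j, ?_⟩
    rw [e, Finset.sum_eq_single j (fun k _ hk => by rw [hz k hk, zero_smul]) (by simp)]
  -- If neither `g` nor `g * s i` were the identity, both would send `α i` to a nonpositive multiple
  -- of itself, while their values there are opposite.
  by_contra hcon
  push Not at hcon
  obtain ⟨c, hc, hgc⟩ := key g n hg hfg hcon.1
  obtain ⟨d, hd, hgd⟩ := key (g * s i) (n + 1) (hg.mul (HasWord.gen s i))
    (fun v => by rw [LinearEquiv.mul_apply, hfg, hfi]) (fun h1 => hcon.2 (by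
      rw [← mul_one g, ← h.mul_self i, ← mul_assoc, h1, one_mul]))
  rw [LinearEquiv.mul_apply, h.apply_self, map_neg, hgc, neg_neg] at hgd
  have h0 : (c + d) • α i = 0 := by
    rw [add_smul, hgd]
    simp
  have hc0 : c = 0 := by
    have := (smul_eq_zero.1 h0).resolve_right hαi
    linarith
  rw [hc0, zero_smul, neg_zero, LinearEquiv.map_eq_zero_iff] at hgc
  exact hαi hgc

end Roots


/-! ### The geometric representation of the triangle group -/

/-- Powers of `T` reduce to combinations of `T` and `1` with Chebyshev coefficients `sin (kθ) / sin
θ`; at `k = m` only `-1` remains. -/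
lemma pow_eq_neg_one_of_mul_self {R : Type*} [Ring R] [Algebra ℝ R] {T : R} {m : ℕ} (hm : 2 ≤ m)
    (hT : T * T = (2 * Real.cos (Real.pi / m)) • T - 1) : T ^ m = -1 := by
  have hm' : (2 : ℝ) ≤ m := by exact_mod_cast hm
  set θ := Real.pi / m with hθ
  have hs : Real.sin θ ≠ 0 := by
    refine (Real.sin_pos_of_pos_of_lt_pi (by positivity) (div_lt_self Real.pi_pos ?_)).ne'
    linarith
  have key : ∀ k : ℕ, Real.sin θ • T ^ k = Real.sin (k * θ) • T - Real.sin ((k - 1) * θ) • 1 := by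
    intro k
    induction k with
    | zero => simp
    | succ k ih =>
      rw [pow_succ, ← smul_mul_assoc, ih, sub_mul, smul_mul_assoc, hT, smul_mul_assoc, one_mul]
      push_cast
      have e1 : Real.sin ((k + 1) * θ) = 2 * Real.cos θ * Real.sin (k * θ)
          - Real.sin ((k - 1) * θ) := by
        rw [show ((k : ℝ) + 1) * θ = k * θ + θ by ring,
          show ((k : ℝ) - 1) * θ = k * θ - θ by ring, Real.sin_add, Real.sin_sub]
        ring
      rw [e1, add_sub_cancel_right]
      module
  have hmθ : m * θ = Real.pi := by
    rw [hθ]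
    field_simp
  have := key m
  rw [hmθ, sub_mul, hmθ, one_mul, Real.sin_pi, Real.sin_pi_sub, zero_smul, zero_sub,
    ← smul_neg] at this
  exact smul_right_injective _ hs this

/-- The action `X ↦ -S X S` of the reflection with unit normal `S`. -/
def conjReflection (S : Matrix (Fin 2) (Fin 2) ℝ) (hS : S * S = 1) :
    Matrix (Fin 2) (Fin 2) ℝ ≃ₗ[ℝ] Matrix (Fin 2) (Fin 2) ℝ :=
  have hinv : ∀ X, -(S * -(S * X * S) * S) = X := fun X => by
    have : -(S * -(S * X * S) * S) = (S * S) * X * (S * S) := by noncomm_ring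
    rw [this, hS, one_mul, mul_one]
  { toFun := fun X => -(S * X * S)
    invFun := fun X => -(S * X * S)
    map_add' := fun X Y => by noncomm_ring
    map_smul' := fun c X => by simp
    left_inv := hinv
    right_inv := hinv }

lemma conjReflection_apply (S : Matrix (Fin 2) (Fin 2) ℝ) (hS : S * S = 1)
    (X : Matrix (Fin 2) (Fin 2) ℝ) : conjReflection S hS X = -(S * X * S) := rfl

lemma conjReflection_apply_of_trace {S T : Matrix (Fin 2) (Fin 2) ℝ} (hS : S * S = 1)
    (hS0 : S.trace = 0) (hT0 : T.trace = 0) {c : ℝ} (h : (S * T).trace = -2 * c) :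
    conjReflection S hS T = T + (2 * c) • S := by
  rw [conjReflection_apply, mul_mul_eq_sub hS0 hS hT0, h]
  module

/-- The product acts as conjugation by `-(S * T)`, whose `m`-th power is `-1` and so acts trivially.
-/
lemma conjReflection_mul_pow {S T : Matrix (Fin 2) (Fin 2) ℝ} (hS : S * S = 1) (hT : T * T = 1)
    (hS0 : S.trace = 0) (hT0 : T.trace = 0) {m : ℕ} (hm : 2 ≤ m)
    (h : (S * T).trace = -2 * Real.cos (Real.pi / m)) :
    (conjReflection S hS * conjReflection T hT) ^ m = 1 := by
  have hrel : ∀ {S T : Matrix (Fin 2) (Fin 2) ℝ}, S * S = 1 → T * T = 1 → S.trace = 0 →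
      T.trace = 0 → (S * T).trace = -2 * Real.cos (Real.pi / m) → (-(S * T)) ^ m = -1 := by
    intro S T hS hT hS0 hT0 h
    refine pow_eq_neg_one_of_mul_self hm ?_
    have h2 := eq_sub_iff_add_eq'.2 (mul_add_mul_of_trace_eq_zero hS0 hT0)
    calc -(S * T) * -(S * T) = S * (T * S) * T := by noncomm_ring
      _ = _ := by
        rw [h2, h, mul_sub, sub_mul]
        have : S * (S * T) * T = 1 := by rw [← mul_assoc, hS, one_mul, hT]
        rw [this]
        simp
  have h1 := hrel hS hT hS0 hT0 h
  have h2 := hrel hT hS hT0 hS0 (by rwa [Matrix.trace_mul_comm])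
  have key : ∀ (k : ℕ) X, ((conjReflection S hS * conjReflection T hT) ^ k) X =
      (-(S * T)) ^ k * X * (-(T * S)) ^ k := by
    intro k
    induction k with
    | zero => simp
    | succ k ih =>
      intro X
      rw [pow_succ, LinearEquiv.mul_apply, ih, LinearEquiv.mul_apply, conjReflection_apply,
        conjReflection_apply, pow_succ (-(S * T)), pow_succ' (-(T * S))]
      noncomm_ring
  ext1 X
  rw [key, h1, h2]
  simp

namespace IsRootSystem

variable {r p q : ℕ} {A B C Q : ℍ} {S : Fin 3 → Matrix (Fin 2) (Fin 2) ℝ} {σ : Fin 3 → ℍ ≃ᵢ ℍ}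

lemma isCoxeterRepresentation (h : IsRootSystem r p q A B C Q S σ) (hr : 2 ≤ r) (hp : 2 ≤ p)
    (hq : 2 ≤ q) :
    IsCoxeterRepresentation (fun i => conjReflection (S i) (h.mul_self i)) S where
  mul_self i := by
    ext1 X
    rw [LinearEquiv.mul_apply]
    exact (conjReflection (S i) (h.mul_self i)).left_inv X
  apply_self i := by
    rw [conjReflection_apply, h.mul_self, one_mul]
  exists_order := by
    have key : ∀ i j, ∀ m : ℕ, 2 ≤ m → (S i * S j).trace = -2 * Real.cos (Real.pi / m) →
        (conjReflection (S i) (h.mul_self i) * conjReflection (S j) (h.mul_self j)) ^ m = 1 ∧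
        conjReflection (S i) (h.mul_self i) (S j) = S j + (2 * Real.cos (Real.pi / m)) • S i ∧
        conjReflection (S j) (h.mul_self j) (S i) = S i + (2 * Real.cos (Real.pi / m)) • S j := by
      intro i j m hm ht
      refine ⟨conjReflection_mul_pow _ _ (h.trace_eq_zero i) (h.trace_eq_zero j) hm ht,
        conjReflection_apply_of_trace _ (h.trace_eq_zero i) (h.trace_eq_zero j) ht,
        conjReflection_apply_of_trace _ (h.trace_eq_zero j) (h.trace_eq_zero i) ?_⟩
      rwa [Matrix.trace_mul_comm]
    have e01 := h.trace_zero_one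
    have e12 := h.trace_one_two
    have e20 := h.trace_two_zero
    have e10 := (Matrix.trace_mul_comm _ _).trans e01
    have e21 := (Matrix.trace_mul_comm _ _).trans e12
    have e02 := (Matrix.trace_mul_comm _ _).trans e20
    intro i j hij
    fin_cases i <;> fin_cases j
    · exact absurd rfl hij
    · exact ⟨q, hq, key 0 1 q hq e01⟩
    · exact ⟨p, hp, key 0 2 p hp e02⟩
    · exact ⟨q, hq, key 1 0 q hq e10⟩
    · exact absurd rfl hij
    · exact ⟨r, hr, key 1 2 r hr e12⟩
    · exact ⟨p, hp, key 2 0 p hp e20⟩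
    · exact ⟨r, hr, key 2 1 r hr e21⟩
    · exact absurd rfl hij

lemma mul_self_isometry (h : IsRootSystem r p q A B C Q S σ) (i : Fin 3) : σ i * σ i = 1 := by
  ext1 z
  apply halfTurn_injective
  rw [IsometryEquiv.mul_apply, h.halfTurn_apply, h.halfTurn_apply]
  exact (conjReflection (S i) (h.mul_self i)).left_inv _

lemma mem_reflectionGroup (h : IsRootSystem r p q A B C Q S σ) (i : Fin 3) :
    σ i ∈ reflectionGroup A B C := by
  rw [h.reflectionGroup_eq]
  exact Subgroup.subset_closure ⟨i, rfl⟩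

lemma exists_word (h : IsRootSystem r p q A B C Q S σ) {g : ℍ ≃ᵢ ℍ}
    (hg : g ∈ reflectionGroup A B C) : ∃ l : List (Fin 3), (l.map σ).prod = g := by
  rw [h.reflectionGroup_eq] at hg
  have hinv : ∀ i, (σ i)⁻¹ = σ i := fun i => inv_eq_of_mul_eq_one_left (h.mul_self_isometry i)
  induction hg using Subgroup.closure_induction with
  | mem x hx =>
    obtain ⟨i, rfl⟩ := hx
    exact ⟨[i], by simp⟩
  | one => exact ⟨[], rfl⟩
  | mul x y _ _ hx hy =>
    obtain ⟨l, rfl⟩ := hx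
    obtain ⟨l', rfl⟩ := hy
    exact ⟨l ++ l', by simp⟩
  | inv x _ hx =>
    obtain ⟨l, rfl⟩ := hx
    refine ⟨l.reverse, ?_⟩
    rw [List.prod_inv_reverse, List.map_map, List.map_reverse]
    congr 2
    exact List.map_congr_left fun i _ => (hinv i).symm

lemma halfTurn_prod_apply (h : IsRootSystem r p q A B C Q S σ) (l : List (Fin 3)) (z : ℍ) :
    halfTurn ((l.map σ).prod z) =
      (l.map fun i => conjReflection (S i) (h.mul_self i)).prod (halfTurn z) := by
  induction l with
  | nil => rfl
  | cons i l ih =>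
    rw [List.map_cons, List.prod_cons, IsometryEquiv.mul_apply, h.halfTurn_apply, ih]
    rfl

lemma trace_prod_mul_prod (h : IsRootSystem r p q A B C Q S σ) (l : List (Fin 3))
    (X Y : Matrix (Fin 2) (Fin 2) ℝ) :
    ((l.map fun i => conjReflection (S i) (h.mul_self i)).prod X *
      (l.map fun i => conjReflection (S i) (h.mul_self i)).prod Y).trace = (X * Y).trace := by
  induction l with
  | nil => rfl
  | cons i l ih =>
    rw [← ih, List.map_cons, List.prod_cons, LinearEquiv.mul_apply, LinearEquiv.mul_apply,
      conjReflection_apply, conjReflection_apply, trace_conj_mul_conj (h.mul_self i)]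

lemma apply_Q (h : IsRootSystem r p q A B C Q S σ) : σ 2 Q = Q := by
  apply halfTurn_injective
  rw [h.halfTurn_apply, mul_mul_eq_sub (h.trace_eq_zero 2) (h.mul_self 2) (trace_halfTurn Q),
    h.two_Q, zero_smul, sub_zero]

/-- The stabilizer of the contact point. -/
theorem eq_one_or_eq_of_apply_eq (h : IsRootSystem r p q A B C Q S σ) (hr : 2 ≤ r) (hp : 2 ≤ p)
    (hq : 2 ≤ q) {g : ℍ ≃ᵢ ℍ} (hg : g ∈ reflectionGroup A B C) (hgQ : g Q = Q) :
    g = 1 ∨ g = σ 2 := by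
  obtain ⟨l, rfl⟩ := h.exists_word hg
  let f : Matrix (Fin 2) (Fin 2) ℝ →ₗ[ℝ] ℝ :=
    (Matrix.traceLinearMap (Fin 2) ℝ ℝ).comp (LinearMap.mulRight ℝ (halfTurn Q))
  have hf : ∀ X, f X = (X * halfTurn Q).trace := fun X => rfl
  have hsin : ∀ n : ℕ, 2 ≤ n → 0 < Real.sin (Real.pi / n) := by
    intro n hn
    have hn' : (2 : ℝ) ≤ n := by exact_mod_cast hn
    exact Real.sin_pos_of_pos_of_lt_pi (by positivity) (div_lt_self Real.pi_pos (by linarith))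
  have hfg : ∀ l : List (Fin 3), (l.map σ).prod Q = Q → ∀ X,
      f ((l.map fun i => conjReflection (S i) (h.mul_self i)).prod X) = f X := by
    intro l hl X
    have := h.trace_prod_mul_prod l X (halfTurn Q)
    rwa [← h.halfTurn_prod_apply, hl] at this
  have key := (h.isCoxeterRepresentation hr hp hq).eq_one_or_eq (i := 2) (f := f) h.two_Q ?_ ?_
    (by simpa using hfg [2] (by simpa using h.apply_Q)) ⟨l, rfl, rfl⟩ (hfg l hgQ)
  · have hext : ∀ l' : List (Fin 3), (l.map fun i => conjReflection (S i) (h.mul_self i)).prod =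
        (l'.map fun i => conjReflection (S i) (h.mul_self i)).prod →
        (l.map σ).prod = (l'.map σ).prod := by
      intro l' hl
      ext1 z
      apply halfTurn_injective
      rw [h.halfTurn_prod_apply, h.halfTurn_prod_apply, hl]
    rcases key with key | key
    · exact Or.inl (hext [] key)
    · exact Or.inr (by simpa using hext [2] (by simpa using key))
  · have hA := Real.sinh_pos_iff.2 (dist_pos.2 h.A_ne_Q)
    have hB := Real.sinh_pos_iff.2 (dist_pos.2 h.B_ne_Q)
    have := hsin r hr
    have := hsin p hp
    intro j hj
    fin_cases j
    · change 0 < (S 0 * halfTurn Q).trace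
      rw [h.zero_Q]
      positivity
    · change 0 < (S 1 * halfTurn Q).trace
      rw [h.one_Q]
      positivity
    · exact absurd rfl hj
  · intro h0
    have := h.mul_self 2
    rw [h0, zero_mul] at this
    exact zero_ne_one this

/-- The sign `ε` is the parity of the word, so that orientation reversing `g` are covered as well.
Conjugation by `P` is all that the comparison of traces needs. -/
lemma exists_conj (h : IsRootSystem r p q A B C Q S σ) {g : ℍ ≃ᵢ ℍ}
    (hg : g ∈ reflectionGroup A B C) : ∃ (ε : ℝ) (P P' : Matrix (Fin 2) (Fin 2) ℝ), ε * ε = 1 ∧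
      P' * P = 1 ∧ ∀ z, halfTurn (g z) = ε • (P * halfTurn z * P') := by
  obtain ⟨l, rfl⟩ := h.exists_word hg
  clear hg
  induction l with
  | nil => exact ⟨1, 1, 1, by simp, by simp, fun z => by simp⟩
  | cons i l ih =>
    obtain ⟨ε, P, P', hε, hP, hz⟩ := ih
    refine ⟨-ε, S i * P, P' * S i, by simpa using hε, ?_, fun z => ?_⟩
    · rw [mul_assoc, ← mul_assoc (S i), h.mul_self, one_mul, hP]
    · rw [List.map_cons, List.prod_cons, IsometryEquiv.mul_apply, h.halfTurn_apply, hz]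
      simp [mul_assoc]

end IsRootSystem


/-! ### The contact graph -/

/-- The rotations by `± 2 π / r` about `A` and by `± 2 π / p` about `B`, as products of two of the
reflections `s i`. -/
def rotation {M : Type*} [Mul M] (s : Fin 3 → M) : Fin 4 → M :=
  ![s 1 * s 2, s 2 * s 1, s 2 * s 0, s 0 * s 2]

lemma neighboursAt_symm {A B C Q V x y : ℍ} {n : ℕ} (h : NeighboursAt A B C Q V n x y) :
    NeighboursAt A B C Q V n y x := by
  obtain ⟨g, hg, k, hk, hV, hx, hy, ha⟩ := h
  exact ⟨k, hk, g, hg, hV.symm, hy, hx, by rw [← hV, angle_comm, ha]⟩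

namespace IsRootSystem

variable {r p q : ℕ} {A B C Q : ℍ} {S : Fin 3 → Matrix (Fin 2) (Fin 2) ℝ} {σ : Fin 3 → ℍ ≃ᵢ ℍ}

lemma apply_eq_self (h : IsRootSystem r p q A B C Q S σ) {i : Fin 3} {V : ℍ}
    (hV : (S i * halfTurn V).trace = 0) : σ i V = V := by
  apply halfTurn_injective
  rw [h.halfTurn_apply, mul_mul_eq_sub (h.trace_eq_zero i) (h.mul_self i) (trace_halfTurn V),
    hV, zero_smul, sub_zero]

lemma cosh_dist_apply (h : IsRootSystem r p q A B C Q S σ) (i : Fin 3) (z : ℍ) :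
    Real.cosh (dist z (σ i z)) = 1 + (S i * halfTurn z).trace ^ 2 / 2 := by
  have e := trace_halfTurn_mul z (σ i z)
  rw [h.halfTurn_apply, mul_mul_eq_sub (h.trace_eq_zero i) (h.mul_self i) (trace_halfTurn z),
    mul_sub, Matrix.trace_sub, trace_halfTurn_mul_self, mul_smul_comm, Matrix.trace_smul,
    Matrix.trace_mul_comm (halfTurn z), smul_eq_mul] at e
  linarith

lemma cosh_dist_apply_Q (h : IsRootSystem r p q A B C Q S σ) {i : Fin 3} {V : ℍ} {n : ℕ}
    (hQ : (S i * halfTurn Q).trace = 2 * Real.sin (Real.pi / n) * Real.sinh (dist V Q)) :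
    Real.cosh (dist Q (σ i Q)) = Real.cosh (dist V Q) * Real.cosh (dist V Q) -
      Real.sinh (dist V Q) * Real.sinh (dist V Q) * Real.cos (2 * Real.pi / n) := by
  rw [h.cosh_dist_apply, hQ, mul_div_assoc, Real.cos_two_mul, Real.cos_sq', ← sq, ← sq,
    Real.cosh_sq]
  ring

/-- Pulled back to `Q`, the neighbour has the same distances from `V` and `Q` as `σ i Q`, so it is
this point or its mirror image under `σ 2`. The representative of the vertex `g Q` is unique up to
the stabilizer of `Q`, which only interchanges the two cases. -/
lemma eq_of_neighboursAt (h : IsRootSystem r p q A B C Q S σ) (hr : 2 ≤ r) (hp : 2 ≤ p)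
    (hq : 2 ≤ q) {i : Fin 3} {V : ℍ} {n : ℕ} (hVQ : V ≠ Q) (hi : (S i * halfTurn V).trace = 0)
    (h2 : (S 2 * halfTurn V).trace = 0)
    (hQ : (S i * halfTurn Q).trace = 2 * Real.sin (Real.pi / n) * Real.sinh (dist V Q))
    {g : ℍ ≃ᵢ ℍ} (hg : g ∈ reflectionGroup A B C) {y : ℍ}
    (hn : NeighboursAt A B C Q V n (g Q) y) :
    y = g ((σ i * σ 2) Q) ∨ y = g ((σ 2 * σ i) Q) := by
  obtain ⟨k, hk, k', hk', hV, hx, rfl, ha⟩ := hn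
  have hu : k⁻¹ (k' Q) = σ i Q ∨ k⁻¹ (k' Q) = σ 2 (σ i Q) := by
    have hc := cosh_dist_eq_of_angle (g Q) (k V) (k' Q)
    rw [ha, hx, k.dist_eq, hV, k'.dist_eq, dist_comm Q V, ← h.cosh_dist_apply_Q hQ] at hc
    have hd : dist (k Q) (k' Q) = dist Q (σ i Q) :=
      Real.cosh_strictMonoOn.injOn dist_nonneg dist_nonneg hc
    have e1 : dist (σ i Q) Q = dist (k⁻¹ (k' Q)) Q := by
      rw [← k.dist_eq (k⁻¹ (k' Q)), IsometryEquiv.apply_inv_self, dist_comm, ← hd, dist_comm]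
    have e2 : dist (σ i Q) V = dist (k⁻¹ (k' Q)) V := by
      rw [← k.dist_eq (k⁻¹ (k' Q)), IsometryEquiv.apply_inv_self, hV, k'.dist_eq]
      conv_lhs => rw [← h.apply_eq_self hi]
      exact (σ i).dist_eq _ _
    rcases halfTurn_eq_or_eq_sub_of_dist_eq hVQ.symm (h.trace_eq_zero 2) (h.mul_self 2) h.two_Q h2
      e1 e2 with e | e
    · exact Or.inl (halfTurn_injective e)
    · refine Or.inr (halfTurn_injective ?_)
      rw [e, h.halfTurn_apply 2,
        mul_mul_eq_sub (h.trace_eq_zero 2) (h.mul_self 2) (trace_halfTurn _)]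
  have hk2 : k' Q = k (σ i Q) ∨ k' Q = k (σ 2 (σ i Q)) := by
    refine hu.imp (fun e => ?_) (fun e => ?_) <;> rw [← e, IsometryEquiv.apply_inv_self]
  have hstab : (k⁻¹ * g) Q = Q := by
    rw [IsometryEquiv.mul_apply, hx, IsometryEquiv.inv_apply_self]
  have h22 : ∀ z, σ 2 (σ 2 z) = z := fun z => by
    rw [← IsometryEquiv.mul_apply, h.mul_self_isometry]
    rfl
  rw [IsometryEquiv.mul_apply, IsometryEquiv.mul_apply, h.apply_Q]
  rcases h.eq_one_or_eq_of_apply_eq hr hp hq (mul_mem (inv_mem hk) hg) hstab with e | e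
  · rw [inv_mul_eq_one] at e
    rwa [← e]
  · rw [inv_mul_eq_iff_eq_mul] at e
    rw [e, IsometryEquiv.mul_apply, IsometryEquiv.mul_apply, h22]
    exact hk2.symm

lemma neighboursAt_of_dist_eq (h : IsRootSystem r p q A B C Q S σ) {i : Fin 3} {V : ℍ} {n : ℕ}
    (hn : 2 ≤ n) (hVQ : V ≠ Q)
    (hQ : (S i * halfTurn Q).trace = 2 * Real.sin (Real.pi / n) * Real.sinh (dist V Q))
    {g t : ℍ ≃ᵢ ℍ} (hg : g ∈ reflectionGroup A B C) (ht : t ∈ reflectionGroup A B C)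
    (htV : t V = V) (htQ : dist Q (t Q) = dist Q (σ i Q)) :
    g Q ≠ g (t Q) ∧ NeighboursAt A B C Q V n (g Q) (g (t Q)) := by
  have hs := Real.sinh_pos_iff.2 (dist_pos.2 hVQ)
  have hn' : (2 : ℝ) ≤ n := by exact_mod_cast hn
  constructor
  · intro e
    have hsin : 0 < Real.sin (Real.pi / n) :=
      Real.sin_pos_of_pos_of_lt_pi (by positivity) (div_lt_self Real.pi_pos (by linarith))
    rw [← g.injective e, dist_self, eq_comm, dist_eq_zero] at htQ
    have hc := h.cosh_dist_apply i Q
    rw [← htQ, dist_self, Real.cosh_zero, hQ] at hc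
    have : 0 < (2 * Real.sin (Real.pi / n) * Real.sinh (dist V Q)) ^ 2 / 2 := by positivity
    linarith
  · refine ⟨g, hg, g * t, mul_mem hg ht, ?_, rfl, rfl, ?_⟩
    · rw [IsometryEquiv.mul_apply, htV]
    · have hc := cosh_dist_eq_of_angle (g Q) (g V) (g (t Q))
      have e : dist V (t Q) = dist V Q := by
        conv_lhs => rw [← htV]
        exact t.dist_eq _ _
      rw [g.dist_eq, g.dist_eq, g.dist_eq, e, htQ, h.cosh_dist_apply_Q hQ, dist_comm Q V] at hc
      refine Real.injOn_cos ⟨InnerProductGeometry.angle_nonneg _ _,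
        InnerProductGeometry.angle_le_pi _ _⟩ ⟨by positivity, ?_⟩ ?_
      · rw [div_le_iff₀ (by linarith), mul_comm]
        gcongr
      · have hc' : Real.sinh (dist V Q) * Real.sinh (dist V Q) *
            (Real.cos (angle (g Q) (g V) (g (t Q))) - Real.cos (2 * Real.pi / n)) = 0 := by
          linarith
        have := (mul_eq_zero.1 hc').resolve_left (by positivity)
        exact sub_eq_zero.1 this

lemma rotation_mem (h : IsRootSystem r p q A B C Q S σ) (k : Fin 4) :
    rotation σ k ∈ reflectionGroup A B C := by
  fin_cases k <;> exact mul_mem (h.mem_reflectionGroup _) (h.mem_reflectionGroup _)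

lemma dist_apply_apply (h : IsRootSystem r p q A B C Q S σ) (i : Fin 3) :
    dist Q ((σ 2 * σ i) Q) = dist Q (σ i Q) := by
  rw [IsometryEquiv.mul_apply]
  nth_rewrite 1 [← h.apply_Q]
  exact (σ 2).dist_eq _ _

lemma contactGraph_adj_rotation (h : IsRootSystem r p q A B C Q S σ) (hr : 2 ≤ r) (hp : 2 ≤ p)
    {g : ℍ ≃ᵢ ℍ} (hg : g ∈ reflectionGroup A B C) (k : Fin 4) :
    (contactGraph r p A B C Q).Adj (g Q) (g (rotation σ k Q)) := by
  rw [contactGraph, SimpleGraph.fromRel_adj]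
  have hA1 := h.apply_eq_self h.one_A
  have hA2 := h.apply_eq_self h.two_A
  have hB0 := h.apply_eq_self h.zero_B
  have hB2 := h.apply_eq_self h.two_B
  have hA : ∀ t ∈ reflectionGroup A B C, t A = A → dist Q (t Q) = dist Q (σ 1 Q) → _ :=
    fun t ht => h.neighboursAt_of_dist_eq hr h.A_ne_Q h.one_Q hg ht
  have hB : ∀ t ∈ reflectionGroup A B C, t B = B → dist Q (t Q) = dist Q (σ 0 Q) → _ :=
    fun t ht => h.neighboursAt_of_dist_eq hp h.B_ne_Q h.zero_Q hg ht
  fin_cases k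
  · obtain ⟨h1, h2⟩ := hA (σ 1 * σ 2) (h.rotation_mem 0) (by simp [hA1, hA2]) (by simp [h.apply_Q])
    exact ⟨h1, Or.inl (Or.inl h2)⟩
  · obtain ⟨h1, h2⟩ := hA (σ 2 * σ 1) (h.rotation_mem 1) (by simp [hA1, hA2])
      (h.dist_apply_apply 1)
    exact ⟨h1, Or.inl (Or.inl h2)⟩
  · obtain ⟨h1, h2⟩ := hB (σ 2 * σ 0) (h.rotation_mem 2) (by simp [hB0, hB2])
      (h.dist_apply_apply 0)
    exact ⟨h1, Or.inl (Or.inr h2)⟩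
  · obtain ⟨h1, h2⟩ := hB (σ 0 * σ 2) (h.rotation_mem 3) (by simp [hB0, hB2]) (by simp [h.apply_Q])
    exact ⟨h1, Or.inl (Or.inr h2)⟩

lemma exists_rotation_of_contactGraph_adj (h : IsRootSystem r p q A B C Q S σ) (hr : 2 ≤ r)
    (hp : 2 ≤ p) (hq : 2 ≤ q) {g : ℍ ≃ᵢ ℍ} (hg : g ∈ reflectionGroup A B C) {y : ℍ}
    (hy : (contactGraph r p A B C Q).Adj (g Q) y) : ∃ k, y = g (rotation σ k Q) := by
  rw [contactGraph, SimpleGraph.fromRel_adj] at hy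
  have hy' : NeighboursAt A B C Q A r (g Q) y ∨ NeighboursAt A B C Q B p (g Q) y := by
    rcases hy.2 with e | e | e
    exacts [e, Or.inl (neighboursAt_symm e), Or.inr (neighboursAt_symm e)]
  rcases hy' with e | e
  · rcases h.eq_of_neighboursAt hr hp hq h.A_ne_Q h.one_A h.two_A h.one_Q hg e with e | e
    exacts [⟨0, e⟩, ⟨1, e⟩]
  · rcases h.eq_of_neighboursAt hr hp hq h.B_ne_Q h.zero_B h.two_B h.zero_Q hg e with e | e
    exacts [⟨3, e⟩, ⟨2, e⟩]

/-- Each step multiplies the current group element on the right by a rotation, since the neighbours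
of `g Q` are the points `g R Q`. -/
lemma exists_word_of_walk (h : IsRootSystem r p q A B C Q S σ) (hr : 2 ≤ r) (hp : 2 ≤ p)
    (hq : 2 ≤ q) {x y : ℍ} (w : (contactGraph r p A B C Q).Walk x y) {g : ℍ ≃ᵢ ℍ}
    (hg : g ∈ reflectionGroup A B C) (hx : x = g Q) :
    ∃ l : List (Fin 4), l.length = w.length ∧ y = g ((l.map (rotation σ)).prod Q) := by
  induction w generalizing g with
  | nil => exact ⟨[], rfl, hx⟩
  | cons hadj w ih =>
    subst hx
    obtain ⟨k, rfl⟩ := h.exists_rotation_of_contactGraph_adj hr hp hq hg hadj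
    obtain ⟨l, hl, rfl⟩ := ih (mul_mem hg (h.rotation_mem k)) rfl
    exact ⟨k :: l, by rw [List.length_cons, hl]; rfl, by simp⟩

lemma edist_le_length (h : IsRootSystem r p q A B C Q S σ) (hr : 2 ≤ r) (hp : 2 ≤ p)
    (l : List (Fin 4)) {g : ℍ ≃ᵢ ℍ} (hg : g ∈ reflectionGroup A B C) :
    (contactGraph r p A B C Q).edist (g Q) (g ((l.map (rotation σ)).prod Q)) ≤ l.length := by
  induction l generalizing g with
  | nil => simp
  | cons k l ih =>
    have h1 := h.contactGraph_adj_rotation hr hp hg k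
    have h2 := ih (mul_mem hg (h.rotation_mem k))
    rw [List.map_cons, List.prod_cons, IsometryEquiv.mul_apply, List.length_cons]
    refine (SimpleGraph.edist_triangle (v := g (rotation σ k Q))).trans ?_
    rw [SimpleGraph.edist_eq_one_iff_adj.2 h1, add_comm]
    push_cast
    gcongr
    exact h2

/-! ### Traces of elements of low level -/

lemma exists_smul_eq (h : IsRootSystem r p q A B C Q S σ) (l : List (Fin 4)) :
    ∃ W : SL(2, ℝ), (W : Matrix (Fin 2) (Fin 2) ℝ) = (l.map (rotation S)).prod ∧
      ∀ z, (l.map (rotation σ)).prod z = W • z := by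
  have hdet : ∀ i, (S i).det = -1 := by
    intro i
    have h1 := h.mul_self i
    obtain ⟨a, b, c, hS⟩ := exists_eq_of_trace_eq_zero (h.trace_eq_zero i)
    rw [hS] at h1 ⊢
    have := congrFun₂ h1 0 0
    simp at this
    simp
    linarith
  have key : ∀ i j, ∃ W : SL(2, ℝ), (W : Matrix (Fin 2) (Fin 2) ℝ) = S i * S j ∧
      ∀ z, (σ i * σ j) z = W • z := by
    intro i j
    let W : SL(2, ℝ) := ⟨S i * S j, by rw [Matrix.det_mul, hdet, hdet]; norm_num⟩
    let W' : SL(2, ℝ) := ⟨S j * S i, by rw [Matrix.det_mul, hdet, hdet]; norm_num⟩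
    have hW : W⁻¹ = W' := by
      rw [inv_eq_iff_mul_eq_one]
      apply Subtype.ext
      change S i * S j * (S j * S i) = 1
      rw [mul_assoc, ← mul_assoc (S j), h.mul_self, one_mul, h.mul_self]
    refine ⟨W, rfl, fun z => halfTurn_injective ?_⟩
    rw [halfTurn_smul, hW, IsometryEquiv.mul_apply, h.halfTurn_apply, h.halfTurn_apply]
    change _ = S i * S j * halfTurn z * (S j * S i)
    noncomm_ring
  induction l with
  | nil => exact ⟨1, rfl, fun z => (one_smul _ z).symm⟩
  | cons k l ih =>
    obtain ⟨W, hW, hWz⟩ := ih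
    obtain ⟨R, hR, hRz⟩ : ∃ R : SL(2, ℝ), (R : Matrix (Fin 2) (Fin 2) ℝ) = rotation S k ∧
        ∀ z, rotation σ k z = R • z := by
      fin_cases k <;> exact key _ _
    refine ⟨R * W, ?_, fun z => ?_⟩
    · rw [Matrix.SpecialLinearGroup.coe_mul, hR, hW, List.map_cons, List.prod_cons]
    · rw [List.map_cons, List.prod_cons, IsometryEquiv.mul_apply, hWz, hRz, mul_smul]

end IsRootSystem


lemma conj_triple {R : Type*} [Ring R] {k k' : R} (hk : k' * k = 1) (x y z : R) :
    k * x * k' * (k * y * k') * (k * z * k') = k * (x * y * z) * k' := by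
  have : k * x * k' * (k * y * k') * (k * z * k') =
      k * x * (k' * k) * y * (k' * k) * z * k' := by noncomm_ring
  rw [this, hk]
  noncomm_ring

/-- A reflection does not preserve the orientation. -/
lemma false_of_halfTurn_smul {k : SL(2, ℝ)} {S : Matrix (Fin 2) (Fin 2) ℝ} (hS : S * S = 1)
    (h : ∀ z, halfTurn (k • z) = -(S * halfTurn z * S)) : False := by
  let x : ℍ := ⟨⟨0, 1⟩, one_pos⟩
  let y : ℍ := ⟨⟨1, 1⟩, one_pos⟩
  let z : ℍ := ⟨⟨-1, 1⟩, one_pos⟩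
  have hne : (halfTurn x * halfTurn y * halfTurn z).trace ≠ 0 := by
    simp [x, y, z, halfTurn, Matrix.trace_fin_two, UpperHalfPlane.re, UpperHalfPlane.im]
    norm_num
  have hk : ((k⁻¹ : SL(2, ℝ)) : Matrix (Fin 2) (Fin 2) ℝ) * (k : Matrix (Fin 2) (Fin 2) ℝ) = 1 := by
    rw [← Matrix.SpecialLinearGroup.coe_mul, inv_mul_cancel, Matrix.SpecialLinearGroup.coe_one]
  -- The sign of this triple trace is the orientation of the three points: `SL(2, ℝ)` preserves it
  -- and a reflection reverses it.
  have e1 : (halfTurn (k • x) * halfTurn (k • y) * halfTurn (k • z)).trace =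
      (halfTurn x * halfTurn y * halfTurn z).trace := by
    rw [halfTurn_smul, halfTurn_smul, halfTurn_smul, conj_triple hk, Matrix.trace_mul_comm,
      ← mul_assoc, hk, one_mul]
  have e2 : (halfTurn (k • x) * halfTurn (k • y) * halfTurn (k • z)).trace =
      -(halfTurn x * halfTurn y * halfTurn z).trace := by
    rw [h, h, h, neg_mul_neg, mul_neg, conj_triple hS, Matrix.trace_neg, Matrix.trace_mul_comm,
      ← mul_assoc, hS, one_mul]
  rw [e1] at e2
  exact hne (by linarith)

namespace IsRootSystem

variable {r p q : ℕ} {A B C Q : ℍ} {S : Fin 3 → Matrix (Fin 2) (Fin 2) ℝ} {σ : Fin 3 → ℍ ≃ᵢ ℍ}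

/-- For a path from `g Q` to `γ g Q` with word `ω`, the element `ω⁻¹ g⁻¹ γ g` fixes `Q`. It cannot
be the reflection `σ 2`, since it preserves the orientation, so `γ` is conjugate to `ω`. Traces are
squared because matrices are determined only up to sign. -/
theorem exists_trace_sq_eq (h : IsRootSystem r p q A B C Q S σ) (hr : 2 ≤ r) (hp : 2 ≤ p)
    (hq : 2 ≤ q) {γ : ℍ ≃ᵢ ℍ} (hγ : γ ∈ reflectionGroup A B C) {t : SL(2, ℝ)}
    (ht : ∀ z, γ z = t • z) {n : ℕ} (hl : level r p A B C Q γ ≤ n) :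
    ∃ l : List (Fin 4), l.length ≤ n ∧
      (t : Matrix (Fin 2) (Fin 2) ℝ).trace ^ 2 = (l.map (rotation S)).prod.trace ^ 2 := by
  obtain ⟨x, hx, hxn⟩ : ∃ x ∈ pointSet A B C Q,
      (contactGraph r p A B C Q).edist x (γ x) ≤ n := by
    by_contra hcon
    push Not at hcon
    -- The infimum is attained because distances are integers or infinite: if all exceed `n`, the
    -- infimum is at least `n + 1`.
    have : (n : ℕ∞) + 1 ≤ level r p A B C Q γ :=
      le_iInf₂ fun x hx => Order.add_one_le_of_lt (hcon x hx)
    have := this.trans hl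
    norm_cast at this
    lia
  obtain ⟨g, hg, rfl⟩ := hx
  obtain ⟨w, hw⟩ := SimpleGraph.exists_walk_of_edist_ne_top
    (ne_top_of_le_ne_top (ENat.natCast_ne_top n) hxn)
  rw [← hw] at hxn
  obtain ⟨l, hlen, hend⟩ := h.exists_word_of_walk hr hp hq w hg rfl
  refine ⟨l, by rw [hlen]; exact_mod_cast hxn, ?_⟩
  obtain ⟨W, hW, hWz⟩ := h.exists_smul_eq l
  set ω := (l.map (rotation σ)).prod with hω
  have hωmem : ω ∈ reflectionGroup A B C := by
    refine Subgroup.list_prod_mem _ fun τ hτ => ?_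
    obtain ⟨k, -, rfl⟩ := List.mem_map.1 hτ
    exact h.rotation_mem k
  obtain ⟨ε, P, P', hε, hP, hPz⟩ := h.exists_conj hg
  have hP' : P * P' = 1 := mul_eq_one_comm.1 hP
  let t' : SL(2, ℝ) := ⟨P' * t * P, by
    rw [Matrix.det_mul, Matrix.det_mul, t.det_coe, mul_one, ← Matrix.det_mul, hP, Matrix.det_one]⟩
  have ht' : (t'⁻¹ : SL(2, ℝ)) = P' * (t⁻¹ : SL(2, ℝ)) * P := by
    have : t' * ⟨P' * (t⁻¹ : SL(2, ℝ)) * P, by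
      rw [Matrix.det_mul, Matrix.det_mul, (t⁻¹).det_coe, mul_one, ← Matrix.det_mul, hP,
        Matrix.det_one]⟩ = 1 := by
      apply Subtype.ext
      change P' * t * P * (P' * (t⁻¹ : SL(2, ℝ)) * P) = 1
      calc _ = P' * (t * (P * P') * (t⁻¹ : SL(2, ℝ))) * P := by noncomm_ring
        _ = 1 := by
          rw [hP', mul_one, ← Matrix.SpecialLinearGroup.coe_mul, mul_inv_cancel,
            Matrix.SpecialLinearGroup.coe_one, mul_one, hP]
    rw [inv_eq_of_mul_eq_one_right this]
  have hconj : ∀ z, g⁻¹ (γ (g z)) = t' • z := by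
    intro z
    apply halfTurn_injective
    have e1 : halfTurn (g (g⁻¹ (γ (g z)))) = ε • (P * halfTurn (t' • z) * P') := by
      rw [IsometryEquiv.apply_inv_self, ht, halfTurn_smul, hPz, halfTurn_smul, ht']
      change _ = ε • (P * (P' * t * P * _ * _) * P')
      have : P * (P' * t * P * halfTurn z * (P' * (t⁻¹ : SL(2, ℝ)) * P)) * P' =
          (P * P') * (t * (P * halfTurn z * P') * (t⁻¹ : SL(2, ℝ))) * (P * P') := by noncomm_ring
      rw [this, hP', one_mul, mul_one]
      simp
    rw [hPz] at e1
    have e2 := smul_right_injective _ (left_ne_zero_of_mul (hε ▸ one_ne_zero)) e1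
    have e3 := congrArg (fun X => P' * X * P) e2
    have e4 : ∀ X, P' * (P * X * P') * P = X := fun X => by
      have : P' * (P * X * P') * P = (P' * P) * X * (P' * P) := by noncomm_ring
      rw [this, hP, one_mul, mul_one]
    simpa only [e4] using e3
  have hfix : (ω⁻¹ * (g⁻¹ * γ * g)) Q = Q := by
    simp only [IsometryEquiv.mul_apply]
    rw [hend, IsometryEquiv.inv_apply_self, IsometryEquiv.inv_apply_self]
  have hmem : ω⁻¹ * (g⁻¹ * γ * g) ∈ reflectionGroup A B C :=
    mul_mem (inv_mem hωmem) (mul_mem (mul_mem (inv_mem hg) hγ) hg)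
  rcases h.eq_one_or_eq_of_apply_eq hr hp hq hmem hfix with e | e
  · rw [inv_mul_eq_one] at e
    rw [← hW, ← trace_sq_eq_of_smul_eq (g := t') (h := W) fun z => by
      rw [← hWz, ← hconj, e]; rfl]
    change _ = (P' * t * P).trace ^ 2
    rw [mul_assoc, Matrix.trace_mul_comm, mul_assoc, hP', mul_one]
  · refine (false_of_halfTurn_smul (k := W⁻¹ * t') (h.mul_self 2) fun z => ?_).elim
    rw [← h.halfTurn_apply, ← e]
    congr 1
    rw [mul_smul, inv_smul_eq_iff, ← hWz, ← hconj]
    simp only [IsometryEquiv.mul_apply]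
    rw [IsometryEquiv.apply_inv_self]

lemma mem_lowLevelLengths (h : IsRootSystem r p q A B C Q S σ) (hr : 2 ≤ r) (hp : 2 ≤ p)
    (l : List (Fin 4)) (hl : l.length ≤ 4) {L : ℝ} (hL : 2 < L)
    (hlL : |(l.map (rotation S)).prod.trace| = L) :
    2 * Real.arcosh (L / 2) ∈ lowLevelLengths r p A B C Q := by
  obtain ⟨W, hW, hWz⟩ := h.exists_smul_eq l
  have h4 : 4 < (W : Matrix (Fin 2) (Fin 2) ℝ).trace ^ 2 := by
    rw [hW, ← sq_abs, hlL]
    nlinarith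
  refine ⟨(l.map (rotation σ)).prod, ⟨?_, W, hWz⟩, (isHyperbolic_iff hWz).2 h4, ?_, ?_⟩
  · refine Subgroup.list_prod_mem _ fun τ hτ => ?_
    obtain ⟨k, -, rfl⟩ := List.mem_map.1 hτ
    exact h.rotation_mem k
  · refine (iInf₂_le Q ⟨1, one_mem _, rfl⟩).trans ?_
    refine (h.edist_le_length hr hp l (one_mem _)).trans ?_
    exact_mod_cast hl
  · rw [translationLength_eq hWz h4, hW, hlL]

end IsRootSystem


/-! ### Traces of short words -/

/-- The real number `t` has absolute value at most `2`, or equal to one of the two smallest of the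
three numbers `x y + z`, `x z + y`, `y z + x`, or at least equal to the third. -/
def IsAdmissible (x y z t : ℝ) : Prop :=
  |t| ≤ 2 ∨ |t| = x * y + z ∨ |t| = x * z + y ∨ y * z + x ≤ |t|

lemma isAdmissible_neg {x y z t : ℝ} (h : IsAdmissible x y z t) : IsAdmissible x y z (-t) := by
  rwa [IsAdmissible, abs_neg]

lemma IsAdmissible.of_le {x y z t : ℝ} (h : y * z + x ≤ t) : IsAdmissible x y z t :=
  Or.inr (Or.inr (Or.inr (h.trans (le_abs_self t))))

lemma IsAdmissible.of_small {x y z t : ℝ} (h1 : -2 ≤ t) (h2 : t ≤ 2) : IsAdmissible x y z t :=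
  Or.inl (abs_le.2 ⟨h1, h2⟩)

/-- The value of `2 cos (π / n)` for an integer `n ≥ 3` is `1`, `√2`, the golden ratio, or at
least `√3`. -/
def IsCosValue (x : ℝ) : Prop :=
  1 ≤ x ∧ x < 2 ∧ (x = 1 ∨ x ^ 2 = 2 ∨ x ^ 2 = x + 1 ∨ 3 ≤ x ^ 2)

lemma isCosValue_two_mul_cos {n : ℕ} (hn : 3 ≤ n) : IsCosValue (2 * Real.cos (Real.pi / n)) := by
  have hn' : (3 : ℝ) ≤ n := by exact_mod_cast hn
  have hanti : ∀ m : ℕ, 1 ≤ m → m ≤ n → Real.cos (Real.pi / m) ≤ Real.cos (Real.pi / n) := by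
    intro m hm hmn
    have hm' : (1 : ℝ) ≤ m := by exact_mod_cast hm
    have hmn' : (m : ℝ) ≤ n := by exact_mod_cast hmn
    refine Real.cos_le_cos_of_nonneg_of_le_pi (by positivity) (div_le_self Real.pi_pos.le hm') ?_
    exact div_le_div_of_nonneg_left Real.pi_pos.le (by linarith) hmn'
  have h3 := hanti 3 (by lia) hn
  push_cast at h3
  rw [Real.cos_pi_div_three] at h3
  refine ⟨by linarith, ?_, ?_⟩
  · have : Real.cos (Real.pi / n) < Real.cos 0 := by
      refine Real.cos_lt_cos_of_nonneg_of_le_pi le_rfl ?_ (by positivity)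
      exact div_le_self Real.pi_pos.le (by linarith)
    rw [Real.cos_zero] at this
    linarith
  · rcases Nat.lt_or_ge n 6 with h | h
    · interval_cases n
      · left
        push_cast
        rw [Real.cos_pi_div_three]
        norm_num
      · right; left
        push_cast
        rw [Real.cos_pi_div_four, mul_pow, div_pow, Real.sq_sqrt (by norm_num)]
        norm_num
      · right; right; left
        push_cast
        have : 4 * Real.cos (Real.pi / 5) ^ 2 - 2 * Real.cos (Real.pi / 5) - 1 = 0 :=
          Real.quadratic_root_cos_pi_div_five
        linarith
    · right; right; right
      have h6 := hanti 6 (by lia) h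
      push_cast at h6
      rw [Real.cos_pi_div_six] at h6
      have : √3 ^ 2 ≤ (2 * Real.cos (Real.pi / n)) ^ 2 := by
        gcongr
        linarith
      rwa [Real.sq_sqrt (by norm_num)] at this

/-! ### Bounds for the trace polynomials of the base words -/

section Inequalities

variable {x y z : ℝ}

/-- After `1` and `√2`, the values are at least the golden ratio, hence `x + 1 ≤ x ^ 2`. -/
lemma IsCosValue.three_halves_le (hx : IsCosValue x) (h1 : x ≠ 1) (h2 : x ^ 2 ≠ 2) :
    8 / 5 ≤ x ∧ x + 1 ≤ x ^ 2 := by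
  obtain ⟨h, h', h3⟩ := hx
  rcases h3 with h3 | h3 | h3 | h3
  · exact absurd h3 h1
  · exact absurd h3 h2
  · exact ⟨by nlinarith, h3.ge⟩
  · exact ⟨by nlinarith, by linarith⟩

lemma IsCosValue.eq_one_or (hx : IsCosValue x) : x = 1 ∨ 2 ≤ x ^ 2 := by
  obtain ⟨h, h', h3⟩ := hx
  rcases h3 with h3 | h3 | h3 | h3
  · exact Or.inl h3
  all_goals right; linarith

/-- The suffix of the name spells the word, a prime marking an inverse. For `x = 1` the value is
`z`, for `x ^ 2 = 2` it is `x * z + y`; otherwise it is at least `x * y + x * z`, which exceeds `y *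
z + x`. -/
lemma isAdmissible_xxy' (hx : IsCosValue x) (hy : IsCosValue y) (hz : IsCosValue z) (hxy : x ≤ y)
    (hyz : y ≤ z) : IsAdmissible x y z (x ^ 2 * y + x * z - y) := by
  obtain ⟨hx1, hx2, h⟩ := hx
  obtain ⟨hy1, hy2, -⟩ := hy
  obtain ⟨hz1, hz2, -⟩ := hz
  rcases eq_or_ne x 1 with e | e
  · rw [e]
    exact .of_small (by linarith) (by linarith)
  rcases eq_or_ne (x ^ 2) 2 with e2 | e2
  · right; right; left
    rw [e2, abs_of_nonneg (by nlinarith)]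
    ring
  · obtain ⟨h1, h2⟩ := IsCosValue.three_halves_le ⟨hx1, hx2, h⟩ e e2
    refine .of_le ?_
    nlinarith [mul_le_mul_of_nonneg_right h2 (by linarith : 0 ≤ y),
      mul_nonneg (by linarith : 0 ≤ y - x) (by linarith : 0 ≤ 2 - z)]

lemma isAdmissible_xy'y' (hx : IsCosValue x) (hy : IsCosValue y) (hz : IsCosValue z) (hxy : x ≤ y)
    (hyz : y ≤ z) : IsAdmissible x y z (x * y ^ 2 + y * z - x) := by
  obtain ⟨hx1, hx2, -⟩ := hx
  obtain ⟨hy1, hy2, h⟩ := hy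
  obtain ⟨hz1, hz2, -⟩ := hz
  rcases IsCosValue.eq_one_or ⟨hy1, hy2, h⟩ with e | e
  · rw [e]
    exact .of_small (by linarith) (by linarith)
  · refine .of_le ?_
    nlinarith

lemma isAdmissible_xxxy (hx : IsCosValue x) (hy : IsCosValue y) (hz : IsCosValue z) (hxy : x ≤ y)
    (hyz : y ≤ z) : IsAdmissible x y z ((x ^ 2 - 1) * z + x * y) := by
  obtain ⟨hx1, hx2, h⟩ := hx
  obtain ⟨hy1, hy2, -⟩ := hy
  obtain ⟨hz1, hz2, -⟩ := hz
  rcases eq_or_ne x 1 with e | e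
  · rw [e]
    exact .of_small (by linarith) (by linarith)
  rcases eq_or_ne (x ^ 2) 2 with e2 | e2
  · right; left
    rw [e2, abs_of_nonneg (by nlinarith)]
    ring
  · obtain ⟨h1, h2⟩ := IsCosValue.three_halves_le ⟨hx1, hx2, h⟩ e e2
    refine .of_le ?_
    nlinarith [mul_le_mul_of_nonneg_right h2 (by linarith : 0 ≤ z),
      mul_nonneg (by linarith : 0 ≤ y - x) (by linarith : 0 ≤ 2 - z)]

/-- The golden ratio gives `x * z + y` exactly, which is why it is a separate case in `IsCosValue`.
-/
lemma isAdmissible_xxxy' (hx : IsCosValue x) (hy : IsCosValue y) (hz : IsCosValue z) (hxy : x ≤ y)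
    (hyz : y ≤ z) : IsAdmissible x y z ((x ^ 2 - 1) * (x * y + z) - x * y) := by
  obtain ⟨hx1, hx2, h⟩ := hx
  obtain ⟨hy1, hy2, -⟩ := hy
  obtain ⟨hz1, hz2, -⟩ := hz
  have hxy0 : 0 < x * y := by positivity
  have hxz0 : 0 < x * z := by positivity
  rcases h with e | e | e | e
  · rw [e]
    exact .of_small (by linarith) (by linarith)
  · rw [e]
    exact .of_small (by linarith) (by linarith)
  · right; right; left
    have : (x ^ 2 - 1) * (x * y + z) - x * y = x * z + y := by
      rw [e]
      linear_combination y * e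
    rw [this, abs_of_nonneg (by linarith)]
  · refine .of_le ?_
    nlinarith [mul_nonneg (by linarith : 0 ≤ x ^ 2 - 3) (by linarith : 0 ≤ x * y + z)]

lemma isAdmissible_xyyy (hx : IsCosValue x) (hy : IsCosValue y) (hz : IsCosValue z) (hxy : x ≤ y)
    (hyz : y ≤ z) : IsAdmissible x y z ((y ^ 2 - 1) * z + x * y) := by
  obtain ⟨hx1, hx2, -⟩ := hx
  obtain ⟨hy1, hy2, h⟩ := hy
  obtain ⟨hz1, hz2, -⟩ := hz
  rcases eq_or_ne y 1 with e | e
  · rw [e]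
    exact .of_small (by linarith) (by linarith)
  rcases eq_or_ne (y ^ 2) 2 with e2 | e2
  · right; left
    rw [e2, abs_of_nonneg (by nlinarith)]
    ring
  · obtain ⟨h1, h2⟩ := IsCosValue.three_halves_le ⟨hy1, hy2, h⟩ e e2
    refine .of_le ?_
    nlinarith [mul_le_mul_of_nonneg_right h2 (by linarith : 0 ≤ z)]

lemma isAdmissible_xy'y'y' (hx : IsCosValue x) (hy : IsCosValue y) (hz : IsCosValue z)
    (hxy : x ≤ y) (hyz : y ≤ z) : IsAdmissible x y z ((y ^ 2 - 1) * (x * y + z) - x * y) := by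
  obtain ⟨hx1, hx2, -⟩ := hx
  obtain ⟨hy1, hy2, h⟩ := hy
  obtain ⟨hz1, hz2, -⟩ := hz
  have hxy0 : 0 < x * y := by positivity
  rcases h with e | e | e | e
  · rw [e]
    exact .of_small (by linarith) (by linarith)
  · rw [e]
    exact .of_small (by linarith) (by linarith)
  · refine .of_le (le_of_eq ?_)
    rw [e]
    linear_combination -x * e
  · refine .of_le ?_
    nlinarith [mul_nonneg (by linarith : 0 ≤ y ^ 2 - 3) (by linarith : 0 ≤ x * y + z)]

lemma isAdmissible_xxyy (hx : IsCosValue x) (hy : IsCosValue y) (hz : IsCosValue z) (hxy : x ≤ y)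
    (hyz : y ≤ z) : IsAdmissible x y z (x * y * z + x ^ 2 + y ^ 2 - 2) := by
  obtain ⟨hy1, hy2, -⟩ := id hy
  obtain ⟨hx1, hx2, -⟩ := id hx
  obtain ⟨hz1, hz2, -⟩ := hz
  have hyz0 : 0 < y * z := by positivity
  rcases hx.eq_one_or with e | e
  · rw [e]
    rcases hy.eq_one_or with e' | e'
    · rw [e']
      exact .of_small (by linarith) (by linarith)
    · exact .of_le (by linarith)
  · exact .of_le (by nlinarith)

lemma isAdmissible_xxy'y' (hx : IsCosValue x) (hy : IsCosValue y) (hz : IsCosValue z) :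
    IsAdmissible x y z (x * y * (x * y + z) - x ^ 2 - y ^ 2 + 2) := by
  obtain ⟨hy1, hy2, -⟩ := hy
  obtain ⟨hx1, hx2, -⟩ := hx
  obtain ⟨hz1, hz2, -⟩ := hz
  have hyz : 1 ≤ y * z := by nlinarith
  refine .of_le ?_
  -- The excess over `y * z + x` is exactly `(x ^ 2 - 1) * (y ^ 2 - 1) + (x - 1) * (y * z - 1)`.
  nlinarith [mul_nonneg (by nlinarith : 0 ≤ x ^ 2 - 1) (by nlinarith : 0 ≤ y ^ 2 - 1),
    mul_nonneg (by linarith : 0 ≤ x - 1) (by linarith : 0 ≤ y * z - 1)]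

lemma isAdmissible_xyxy' (hx : IsCosValue x) (hy : IsCosValue y) (hz : IsCosValue z)
    (hxy : x ≤ y) (hz2 : 2 ≤ z ^ 2) : IsAdmissible x y z (z * (x * y + z) + y ^ 2 - 2) := by
  obtain ⟨hy1, hy2, -⟩ := hy
  obtain ⟨hx1, hx2, -⟩ := id hx
  obtain ⟨hz1, hz2', -⟩ := hz
  have hyz : 1 ≤ y * z := by nlinarith
  refine .of_le ?_
  rcases hx.eq_one_or with e | e
  · rw [e]
    nlinarith
  · nlinarith

lemma isAdmissible_xyx'y (hx : IsCosValue x) (hy : IsCosValue y) (hz : IsCosValue z)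
    (hz2 : 2 ≤ z ^ 2) : IsAdmissible x y z (z * (x * y + z) + x ^ 2 - 2) := by
  obtain ⟨hy1, hy2, -⟩ := hy
  obtain ⟨hx1, hx2, -⟩ := id hx
  obtain ⟨hz1, hz2', -⟩ := hz
  have hyz : 1 ≤ y * z := by nlinarith
  refine .of_le ?_
  rcases hx.eq_one_or with e | e
  · rw [e]
    nlinarith
  · nlinarith

/-- Fricke's formula for the trace of a commutator; the sign of `x * y * z` is positive because the
product of the two generators has trace `-z`. -/
lemma isAdmissible_commutator (hx : IsCosValue x) (hy : IsCosValue y) (hz : IsCosValue z)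
    (hz2 : 2 ≤ z ^ 2) : IsAdmissible x y z (x ^ 2 + y ^ 2 + z ^ 2 + x * y * z - 2) := by
  obtain ⟨hy1, hy2, -⟩ := hy
  obtain ⟨hx1, hx2, -⟩ := hx
  obtain ⟨hz1, hz2', -⟩ := hz
  have hyz : 1 ≤ y * z := by nlinarith
  refine .of_le ?_
  nlinarith

lemma isAdmissible_xy'xy' (hx : IsCosValue x) (hy : IsCosValue y) (hz : IsCosValue z)
    (hz2 : 2 ≤ z ^ 2) : IsAdmissible x y z ((x * y + z) ^ 2 - 2) := by
  obtain ⟨hy1, hy2, -⟩ := hy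
  obtain ⟨hx1, hx2, -⟩ := hx
  obtain ⟨hz1, hz2', -⟩ := hz
  have hyz : 1 ≤ y * z := by nlinarith
  have hxy : x ≤ x * y := by nlinarith
  refine .of_le ?_
  nlinarith [mul_le_mul_of_nonneg_right hx1 (by linarith : 0 ≤ y * z),
    mul_le_mul hxy hxy (by linarith) (by linarith)]

end Inequalities


/-! ### Words in two elements of `SL(2, ℝ)` -/

/-- `X 0` and `X 2` have determinant one and inverses `X 1` and `X 3`; the traces of `X 0`, `X 2`
and `X 0 * X 2` are `x`, `y` and `-z`. -/
structure IsGeneratingPair (X : Fin 4 → Matrix (Fin 2) (Fin 2) ℝ) (x y z : ℝ) : Prop where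
  sq_zero : X 0 * X 0 = x • X 0 - 1
  sq_two : X 2 * X 2 = y • X 2 - 1
  one_eq : X 1 = x • 1 - X 0
  three_eq : X 3 = y • 1 - X 2
  trace_zero : (X 0).trace = x
  trace_two : (X 2).trace = y
  trace_mul : (X 0 * X 2).trace = -z

/-- The index of the inverse of a generator. -/
def invIndex : Fin 4 → Fin 4 := ![1, 0, 3, 2]

lemma adjugate_eq_trace_smul_sub (M : Matrix (Fin 2) (Fin 2) ℝ) :
    M.adjugate = M.trace • 1 - M := by
  rw [Matrix.adjugate_fin_two]
  ext i j
  fin_cases i <;> fin_cases j <;> simp [Matrix.trace_fin_two]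

namespace IsGeneratingPair

variable {X : Fin 4 → Matrix (Fin 2) (Fin 2) ℝ} {x y z : ℝ}

lemma mul_inv (h : IsGeneratingPair X x y z) (k : Fin 4) : X k * X (invIndex k) = 1 := by
  have e0 : X 0 * X 1 = 1 := by
    rw [h.one_eq, mul_sub, h.sq_zero]
    simp
  have e2 : X 2 * X 3 = 1 := by
    rw [h.three_eq, mul_sub, h.sq_two]
    simp
  fin_cases k
  exacts [e0, mul_eq_one_comm.1 e0, e2, mul_eq_one_comm.1 e2]

/-- The adjugate reverses products, preserves the trace of a 2×2 matrix, and inverts each generator.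
-/
lemma trace_reverse (h : IsGeneratingPair X x y z) (l : List (Fin 4)) :
    ((l.map X).prod).trace = (((l.map invIndex).reverse.map X).prod).trace := by
  have hadj : ∀ k, (X k).adjugate = X (invIndex k) := by
    intro k
    rw [adjugate_eq_trace_smul_sub]
    fin_cases k <;> simp [invIndex, h.one_eq, h.three_eq, h.trace_zero, h.trace_two] <;> module
  have : ((l.map invIndex).reverse.map X).prod = (l.map X).prod.adjugate := by
    induction l with
    | nil => simp
    | cons k l ih =>
      rw [List.map_cons, List.reverse_cons, List.map_append, List.prod_append, ih,
        List.map_cons (l := l), List.prod_cons (l := List.map X l), Matrix.adjugate_mul_distrib,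
        hadj]
      simp
  rw [this, Matrix.adjugate_fin_two, Matrix.trace_fin_two, Matrix.trace_fin_two]
  simp [add_comm]

lemma trace_append_comm (X : Fin 4 → Matrix (Fin 2) (Fin 2) ℝ) (l l' : List (Fin 4)) :
    (((l ++ l').map X).prod).trace = (((l' ++ l).map X).prod).trace := by
  rw [List.map_append, List.prod_append, Matrix.trace_mul_comm, List.map_append, List.prod_append]

lemma trace_cancel (h : IsGeneratingPair X x y z) (k : Fin 4) (l : List (Fin 4)) :
    (((k :: invIndex k :: l).map X).prod).trace = ((l.map X).prod).trace := by
  rw [List.map_cons, List.prod_cons, List.map_cons, List.prod_cons, ← mul_assoc, h.mul_inv, one_mul]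

end IsGeneratingPair

/-- The rotations of a word. -/
def rotations (l : List (Fin 4)) : List (List (Fin 4)) :=
  (List.range l.length).map fun i => l.drop i ++ l.take i

/-- Representatives of the cyclically reduced words of length at most four, up to rotation and
inversion. -/
def baseWords : List (List (Fin 4)) :=
  [[], [0], [2], [0, 0], [2, 2], [0, 2], [0, 3], [0, 0, 0], [2, 2, 2], [0, 0, 2], [0, 0, 3],
    [0, 2, 2], [0, 3, 3], [0, 0, 0, 0], [2, 2, 2, 2], [0, 0, 0, 2], [0, 0, 0, 3], [0, 2, 2, 2],
    [0, 3, 3, 3], [0, 0, 2, 2], [0, 0, 3, 3], [0, 2, 0, 2], [0, 3, 0, 3], [0, 2, 0, 3],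
    [0, 2, 1, 2], [0, 2, 1, 3]]

/-- A word that represents one of the base words, or begins with two letters that cancel. -/
def IsReducedForm (l : List (Fin 4)) : Prop :=
  l ∈ baseWords ∨ l[1]? = l[0]?.map invIndex

instance (l : List (Fin 4)) : Decidable (IsReducedForm l) :=
  inferInstanceAs (Decidable (_ ∨ _))

lemma exists_isReducedForm_one : ∀ a : Fin 4,
    ∃ m ∈ rotations [a] ++ rotations ([a].map invIndex).reverse, IsReducedForm m := by
  decide

lemma exists_isReducedForm_two : ∀ a b : Fin 4,
    ∃ m ∈ rotations [a, b] ++ rotations ([a, b].map invIndex).reverse, IsReducedForm m := by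
  decide

lemma exists_isReducedForm_three : ∀ a b c : Fin 4,
    ∃ m ∈ rotations [a, b, c] ++ rotations ([a, b, c].map invIndex).reverse,
      IsReducedForm m := by
  decide

lemma exists_isReducedForm_four : ∀ a b c d : Fin 4,
    ∃ m ∈ rotations [a, b, c, d] ++ rotations ([a, b, c, d].map invIndex).reverse,
      IsReducedForm m := by
  decide

/-- A finite check: a word that is not cyclically reduced can be rotated so that a cancelling pair
comes first, and the others are listed up to rotation and inversion. -/
lemma exists_isReducedForm (l : List (Fin 4)) (h0 : l ≠ []) (hl : l.length ≤ 4) :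
    ∃ m ∈ rotations l ++ rotations (l.map invIndex).reverse, IsReducedForm m := by
  match l with
  | [] => exact absurd rfl h0
  | [a] => exact exists_isReducedForm_one a
  | [a, b] => exact exists_isReducedForm_two a b
  | [a, b, c] => exact exists_isReducedForm_three a b c
  | [a, b, c, d] => exact exists_isReducedForm_four a b c d
  | _ :: _ :: _ :: _ :: _ :: _ => simp at hl; lia

namespace IsGeneratingPair

variable {X : Fin 4 → Matrix (Fin 2) (Fin 2) ℝ} {x y z : ℝ}

lemma trace_of_mem_rotations (X : Fin 4 → Matrix (Fin 2) (Fin 2) ℝ) {l m : List (Fin 4)}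
    (hm : m ∈ rotations l) :
    ((m.map X).prod).trace = ((l.map X).prod).trace ∧ m.length = l.length := by
  obtain ⟨i, -, rfl⟩ := List.mem_map.1 hm
  constructor
  · rw [trace_append_comm, List.take_append_drop]
  · rw [List.length_append, add_comm, ← List.length_append, List.take_append_drop]

lemma isAdmissible_baseWords (h : IsGeneratingPair X x y z) (hx : IsCosValue x)
    (hy : IsCosValue y) (hz : IsCosValue z) (hz2 : 2 ≤ z ^ 2) (hxy : x ≤ y) (hyz : y ≤ z) :
    ∀ l ∈ baseWords, IsAdmissible x y z ((l.map X).prod).trace := by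
  have hP := h.sq_zero
  have hR := h.sq_two
  have tP := h.trace_zero
  have tR := h.trace_two
  have tPR := h.trace_mul
  have h1 := h.one_eq
  have h3 := h.three_eq
  -- This rule and the next two facts let `simp` reduce every base word to a polynomial in `x`, `y`,
  -- `z`.
  have hP' : ∀ Z, X 0 * (X 0 * Z) = x • (X 0 * Z) - Z := fun Z => by
    rw [← mul_assoc, hP, sub_mul, smul_mul_assoc, one_mul]
  have hPRP : (X 0 * (X 2 * X 0)).trace = -(x * z) - y := by
    rw [Matrix.trace_mul_comm, mul_assoc, hP, mul_sub, Matrix.trace_sub, mul_smul_comm, mul_one,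
      Matrix.trace_smul, Matrix.trace_mul_comm, tPR, tR, smul_eq_mul]
    ring
  -- Cayley–Hamilton for `X 0 * X 2`, which has trace `-z` and determinant `1`.
  have hPRPR : X 0 * (X 2 * (X 0 * X 2)) = -(z • (X 0 * X 2)) - 1 := by
    have hadj : (X 0 * X 2) * (X 0 * X 2).adjugate = 1 := by
      rw [Matrix.adjugate_mul_distrib, adjugate_eq_trace_smul_sub, adjugate_eq_trace_smul_sub,
        tP, tR, ← h1, ← h3, mul_assoc, ← mul_assoc (X 2), show X 2 * X 3 = 1 from h.mul_inv 2,
        one_mul]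
      exact h.mul_inv 0
    rw [adjugate_eq_trace_smul_sub, tPR, mul_sub, mul_smul_comm, mul_one, mul_assoc] at hadj
    rw [← hadj]
    module
  obtain ⟨hx1, hx2, -⟩ := id hx
  obtain ⟨hy1, hy2, -⟩ := id hy
  obtain ⟨hz1, hz3, -⟩ := id hz
  -- Powers of elliptic elements: for `u = 2 cos θ` the three polynomials are `2 cos 2θ`, `2 cos
  -- 3θ`, `2 cos 4θ`.
  have small : ∀ u : ℝ, 1 ≤ u → u < 2 → IsAdmissible x y z (u ^ 2 - 2) := fun u h1 h2 =>
    .of_small (by nlinarith) (by nlinarith)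
  have small3 : ∀ u : ℝ, 1 ≤ u → u < 2 → IsAdmissible x y z (u ^ 3 - 3 * u) := fun u h1 h2 =>
    .of_small (by nlinarith [mul_nonneg (sq_nonneg (u - 1)) (by linarith : 0 ≤ u + 2)])
      (by nlinarith [mul_nonneg (sq_nonneg (u + 1)) (by linarith : 0 ≤ 2 - u)])
  have small4 : ∀ u : ℝ, 1 ≤ u → u < 2 → IsAdmissible x y z (u ^ 4 - 4 * u ^ 2 + 2) :=
    fun u h1 h2 => .of_small (by nlinarith [sq_nonneg (u ^ 2 - 2)])
      (by nlinarith [mul_nonneg (sq_nonneg u) (by nlinarith : 0 ≤ 4 - u ^ 2)])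
  simp only [baseWords, List.forall_mem_cons, List.map_cons, List.map_nil, List.prod_cons,
    List.prod_nil, mul_one, h1, h3, mul_sub, sub_mul, mul_smul_comm, smul_mul_assoc, one_mul,
    hP, hR, hP', hPRP, hPRPR, Matrix.trace_sub, Matrix.trace_smul, Matrix.trace_neg, tP, tR,
    tPR, Matrix.trace_one, Fintype.card_fin, smul_eq_mul]
  push_cast
  refine ⟨?_, ?_, ?_, ?_, ?_, ?_, ?_, ?_, ?_, ?_, ?_, ?_, ?_, ?_, ?_, ?_, ?_, ?_, ?_, ?_, ?_, ?_,
    ?_, ?_, ?_, ?_, by simp⟩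
  · exact .of_small (by norm_num) (by norm_num)
  · exact .of_small (by linarith) (by linarith)
  · exact .of_small (by linarith) (by linarith)
  · convert small x hx1 hx2 using 1; ring
  · convert small y hy1 hy2 using 1; ring
  · exact .of_small (by linarith) (by linarith)
  · have hpos : 0 ≤ x * y := by positivity
    right; left
    rw [abs_of_nonneg (by linarith)]
    ring
  · convert small3 x hx1 hx2 using 1; ring
  · convert small3 y hy1 hy2 using 1; ring
  · have hpos : 0 ≤ x * z := by positivity
    right; right; left
    rw [abs_of_nonpos (by linarith)]
    ring
  · convert isAdmissible_xxy' hx hy hz hxy hyz using 1; ring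
  · convert isAdmissible_neg (IsAdmissible.of_le (le_refl (y * z + x))) using 1; ring
  · convert isAdmissible_xy'y' hx hy hz hxy hyz using 1; ring
  · convert small4 x hx1 hx2 using 1; ring
  · convert small4 y hy1 hy2 using 1; ring
  · convert isAdmissible_neg (isAdmissible_xxxy hx hy hz hxy hyz) using 1; ring
  · convert isAdmissible_xxxy' hx hy hz hxy hyz using 1; ring
  · convert isAdmissible_neg (isAdmissible_xyyy hx hy hz hxy hyz) using 1; ring
  · convert isAdmissible_xy'y'y' hx hy hz hxy hyz using 1; ring
  · convert isAdmissible_neg (isAdmissible_xxyy hx hy hz hxy hyz) using 1; ring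
  · convert isAdmissible_xxy'y' hx hy hz using 1; ring
  · convert small z hz1 hz3 using 1; ring
  · convert isAdmissible_xy'xy' hx hy hz hz2 using 1; ring
  · convert isAdmissible_neg (isAdmissible_xyxy' hx hy hz hxy hz2) using 1; ring
  · convert isAdmissible_neg (isAdmissible_xyx'y hx hy hz hz2) using 1; ring
  · convert isAdmissible_commutator hx hy hz hz2 using 1; ring

/-- Rotation and inversion preserve the trace, and a cancelling pair is removed by induction on the
length. -/
theorem isAdmissible_trace (h : IsGeneratingPair X x y z) (hx : IsCosValue x)
    (hy : IsCosValue y) (hz : IsCosValue z) (hz2 : 2 ≤ z ^ 2) (hxy : x ≤ y) (hyz : y ≤ z)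
    (l : List (Fin 4)) (hl : l.length ≤ 4) : IsAdmissible x y z ((l.map X).prod).trace := by
  induction hn : l.length using Nat.strong_induction_on generalizing l with
  | _ n ih =>
  have hbase := h.isAdmissible_baseWords hx hy hz hz2 hxy hyz
  rcases eq_or_ne l [] with rfl | h0
  · exact hbase [] (by simp [baseWords])
  obtain ⟨m, hm, hred⟩ := exists_isReducedForm l h0 hl
  have hmt : ((m.map X).prod).trace = ((l.map X).prod).trace ∧ m.length = l.length := by
    rcases List.mem_append.1 hm with hm | hm
    · exact trace_of_mem_rotations X hm
    · obtain ⟨e1, e2⟩ := trace_of_mem_rotations X hm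
      exact ⟨by rw [e1, ← h.trace_reverse], by simpa using e2⟩
  rw [← hmt.1]
  rcases hred with hred | hred
  · exact hbase m hred
  · match m, hred, hmt.2 with
    | k :: j :: m', hred, hlen =>
      simp only [List.getElem?_cons_succ, List.getElem?_cons_zero, Option.map_some,
        Option.some.injEq] at hred
      simp only [List.length_cons] at hlen
      rw [hred, h.trace_cancel]
      exact ih m'.length (by lia) m' (by lia) rfl
    | [k], hred, _ => simp at hred
    | [], _, hlen => exact absurd (List.length_eq_zero_iff.1 hlen.symm) h0

end IsGeneratingPair


/-! ### The triangle group as a generating pair -/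

namespace IsRootSystem

variable {r p q : ℕ} {A B C Q : ℍ} {S : Fin 3 → Matrix (Fin 2) (Fin 2) ℝ} {σ : Fin 3 → ℍ ≃ᵢ ℍ}

/-- The sign is chosen so that the generators have positive traces `x` and `y`; the product of the
two is then `S 1 * S 0`, of trace `-z`. -/
lemma isGeneratingPair (h : IsRootSystem r p q A B C Q S σ) :
    IsGeneratingPair (fun k => -rotation S k) (2 * Real.cos (Real.pi / r))
      (2 * Real.cos (Real.pi / p)) (2 * Real.cos (Real.pi / q)) := by
  have key : ∀ i j c, (S i * S j).trace = -2 * c →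
      -(S i * S j) * -(S i * S j) = (2 * c) • -(S i * S j) - 1 ∧
      -(S j * S i) = (2 * c) • 1 - -(S i * S j) ∧ (-(S i * S j)).trace = 2 * c := by
    intro i j c hc
    have h1 := mul_add_mul_of_trace_eq_zero (h.trace_eq_zero i) (h.trace_eq_zero j)
    rw [hc] at h1
    have h2 : S j * S i = (-2 * c) • 1 - S i * S j := eq_sub_iff_add_eq'.2 h1
    refine ⟨?_, ?_, ?_⟩
    · calc -(S i * S j) * -(S i * S j) = S i * (S j * S i) * S j := by noncomm_ring
        _ = (-2 * c) • (S i * S j) - (S i * S i) * (S j * S j) := by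
          rw [h2, mul_sub, sub_mul, mul_smul_comm, mul_one, smul_mul_assoc]
          noncomm_ring
        _ = _ := by
          rw [h.mul_self, h.mul_self]
          simp
    · rw [h2]
      module
    · rw [Matrix.trace_neg, hc]
      ring
  obtain ⟨a1, a2, a3⟩ := key 1 2 _ h.trace_one_two
  obtain ⟨b1, b2, b3⟩ := key 2 0 _ h.trace_two_zero
  refine ⟨a1, b1, a2, b2, a3, b3, ?_⟩
  change (-(S 1 * S 2) * -(S 2 * S 0)).trace = _
  have : -(S 1 * S 2) * -(S 2 * S 0) = S 1 * (S 2 * S 2) * S 0 := by noncomm_ring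
  rw [this, h.mul_self, mul_one, Matrix.trace_mul_comm, h.trace_zero_one]
  ring

lemma abs_trace_prod_neg (S : Fin 3 → Matrix (Fin 2) (Fin 2) ℝ) (l : List (Fin 4)) :
    |((l.map fun k => -rotation S k).prod).trace| = |((l.map (rotation S)).prod).trace| := by
  have : (l.map fun k => -rotation S k).prod = (l.map (rotation S)).prod ∨
      (l.map fun k => -rotation S k).prod = -(l.map (rotation S)).prod := by
    induction l with
    | nil => exact Or.inl rfl
    | cons k l ih =>
      rw [List.map_cons, List.prod_cons, List.map_cons, List.prod_cons]
      rcases ih with e | e <;> rw [e]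
      · exact Or.inr (neg_mul _ _)
      · exact Or.inl (neg_mul_neg _ _)
  rcases this with e | e <;> rw [e]
  rw [Matrix.trace_neg, abs_neg]

end IsRootSystem

/-- The words of which the traces are, up to sign, `x y + z`, `x z + y` and `y z + x`. -/
lemma IsGeneratingPair.trace_words {X : Fin 4 → Matrix (Fin 2) (Fin 2) ℝ} {x y z : ℝ}
    (h : IsGeneratingPair X x y z) :
    (([0, 3].map X).prod).trace = x * y + z ∧ (([0, 0, 2].map X).prod).trace = -(x * z + y) ∧
      (([0, 2, 2].map X).prod).trace = -(y * z + x) := by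
  refine ⟨?_, ?_, ?_⟩
  · simp [h.three_eq, mul_sub, h.trace_zero, h.trace_mul]
    ring
  · simp [← mul_assoc, h.sq_zero, sub_mul, h.trace_two, h.trace_mul]
    ring
  · simp [h.sq_two, mul_sub, h.trace_zero, h.trace_mul]
    ring

end TriangleGroup

theorem proposition13 (r p q : ℕ) (hr : 3 ≤ r) (hrp : r ≤ p) (hpq : p ≤ q)
    (hsum : 1 / (r : ℝ) + 1 / (p : ℝ) + 1 / (q : ℝ) < 1)
    (A B C Q : UpperHalfPlane)
    (hT : TriangleGroup.IsTriangle A B C (Real.pi / r) (Real.pi / p) (Real.pi / q))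
    (hQ : TriangleGroup.IsContactPoint A B C Q)
    (l₁ l₂ l₃ : ℝ)
    (hl₁ : l₁ = 2 * Real.arcosh
      (2 * Real.cos (Real.pi / p) * Real.cos (Real.pi / r) + Real.cos (Real.pi / q)))
    (hl₂ : l₂ = 2 * Real.arcosh
      (2 * Real.cos (Real.pi / q) * Real.cos (Real.pi / r) + Real.cos (Real.pi / p)))
    (hl₃ : l₃ = 2 * Real.arcosh
      (2 * Real.cos (Real.pi / p) * Real.cos (Real.pi / q) + Real.cos (Real.pi / r))) :
    l₁ ≤ l₂ ∧ l₂ ≤ l₃ ∧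
      l₁ ∈ TriangleGroup.lowLevelLengths r p A B C Q ∧
      l₂ ∈ TriangleGroup.lowLevelLengths r p A B C Q ∧
      l₃ ∈ TriangleGroup.lowLevelLengths r p A B C Q ∧
      ∀ l ∈ TriangleGroup.lowLevelLengths r p A B C Q, l = l₁ ∨ l = l₂ ∨ l₃ ≤ l := by
  obtain ⟨S, σ, h⟩ := TriangleGroup.exists_isRootSystem (by lia) (by lia) hT hQ
  have hgen := h.isGeneratingPair
  have hx := TriangleGroup.isCosValue_two_mul_cos hr
  have hy := TriangleGroup.isCosValue_two_mul_cos (hr.trans hrp)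
  have hz := TriangleGroup.isCosValue_two_mul_cos (hr.trans (hrp.trans hpq))
  have hmono : ∀ m n : ℕ, 3 ≤ m → m ≤ n →
      2 * Real.cos (Real.pi / m) ≤ 2 * Real.cos (Real.pi / n) := by
    intro m n hm hmn
    have hm' : (3 : ℝ) ≤ m := by exact_mod_cast hm
    have hmn' : (m : ℝ) ≤ n := by exact_mod_cast hmn
    refine mul_le_mul_of_nonneg_left ?_ two_pos.le
    refine Real.cos_le_cos_of_nonneg_of_le_pi (by positivity)
      (div_le_self Real.pi_pos.le (by linarith)) ?_
    exact div_le_div_of_nonneg_left Real.pi_pos.le (by linarith) hmn'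
  have hxy := hmono r p hr hrp
  have hyz := hmono p q (hr.trans hrp) hpq
  -- The angle condition excludes only `(3, 3, 3)` among the triples with `q = 3`, so `q ≥ 4` and `z
  -- ≥ √2`.
  have hz2 : 2 ≤ (2 * Real.cos (Real.pi / q)) ^ 2 := by
    refine hz.eq_one_or.resolve_left fun e => ?_
    have hq4 : 4 ≤ q := by
      by_contra hlt
      obtain rfl : q = 3 := by lia
      obtain rfl : p = 3 := by lia
      obtain rfl : r = 3 := by lia
      norm_num at hsum
    have h4 := hmono 4 q (by norm_num) hq4
    push_cast at h4
    rw [e, Real.cos_pi_div_four] at h4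
    nlinarith [Real.sq_sqrt (show (0 : ℝ) ≤ 2 by norm_num), Real.sqrt_nonneg 2]
  have harg₁ : l₁ = 2 * Real.arcosh ((2 * Real.cos (Real.pi / r) * (2 * Real.cos (Real.pi / p)) +
      2 * Real.cos (Real.pi / q)) / 2) := by
    rw [hl₁]
    ring_nf
  have harg₂ : l₂ = 2 * Real.arcosh ((2 * Real.cos (Real.pi / r) * (2 * Real.cos (Real.pi / q)) +
      2 * Real.cos (Real.pi / p)) / 2) := by
    rw [hl₂]
    ring_nf
  have harg₃ : l₃ = 2 * Real.arcosh ((2 * Real.cos (Real.pi / p) * (2 * Real.cos (Real.pi / q)) +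
      2 * Real.cos (Real.pi / r)) / 2) := by
    rw [hl₃]
    ring_nf
  have hadm := hgen.isAdmissible_trace hx hy hz hz2 hxy hyz
  obtain ⟨w₁, w₂, w₃⟩ := hgen.trace_words
  replace w₁ := congrArg abs w₁
  replace w₂ := congrArg abs w₂
  replace w₃ := congrArg abs w₃
  rw [TriangleGroup.IsRootSystem.abs_trace_prod_neg] at w₁ w₂ w₃
  rw [abs_neg] at w₂ w₃
  clear hl₁ hl₂ hl₃
  generalize 2 * Real.cos (Real.pi / r) = x at *
  generalize 2 * Real.cos (Real.pi / p) = y at *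
  generalize 2 * Real.cos (Real.pi / q) = z at *
  obtain ⟨hx1, hx2, -⟩ := hx
  obtain ⟨hy1, hy2, -⟩ := hy
  obtain ⟨hz1, hz2', -⟩ := hz
  have i₁ : 2 < x * y + z := by nlinarith
  -- The two gaps are `(x - 1) * (z - y)` and `(z - 1) * (y - x)`.
  have i₁₂ : x * y + z ≤ x * z + y := by nlinarith
  have i₂₃ : x * z + y ≤ y * z + x := by nlinarith
  rw [abs_of_nonneg (a := x * y + z) (by linarith)] at w₁
  rw [abs_of_nonneg (a := x * z + y) (by linarith)] at w₂
  rw [abs_of_nonneg (a := y * z + x) (by linarith)] at w₃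
  have hle : ∀ a b : ℝ, 2 < a → a ≤ b → 2 * Real.arcosh (a / 2) ≤ 2 * Real.arcosh (b / 2) := by
    intro a b ha hab
    have := (Real.arcosh_le_arcosh (x := a / 2) (y := b / 2) (by linarith) (by linarith)).2
      (by linarith)
    linarith
  rw [harg₁, harg₂, harg₃]
  refine ⟨hle _ _ i₁ i₁₂, hle _ _ (by linarith) i₂₃,
    h.mem_lowLevelLengths (by lia) (by lia) [0, 3] (by simp) i₁ w₁,
    h.mem_lowLevelLengths (by lia) (by lia) [0, 0, 2] (by simp) (by linarith) w₂,
    h.mem_lowLevelLengths (by lia) (by lia) [0, 2, 2] (by simp) (by linarith) w₃, ?_⟩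
  rintro l ⟨γ, ⟨hγ, t, ht⟩, hhyp, hlevel, rfl⟩
  rw [TriangleGroup.isHyperbolic_iff ht] at hhyp
  rw [TriangleGroup.translationLength_eq ht hhyp]
  obtain ⟨w, hw, hwt⟩ := h.exists_trace_sq_eq (by lia) (by lia) (by lia) hγ ht (n := 4) hlevel
  have hw' := hadm w hw
  rw [TriangleGroup.IsAdmissible, TriangleGroup.IsRootSystem.abs_trace_prod_neg,
    ← (sq_eq_sq_iff_abs_eq_abs _ _).1 hwt] at hw'
  rcases hw' with e | e | e | e
  -- Words with trace at most `2` in absolute value are not hyperbolic.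
  · rw [← sq_abs] at hhyp
    nlinarith [abs_nonneg (t : Matrix (Fin 2) (Fin 2) ℝ).trace]
  · exact Or.inl (by rw [e])
  · exact Or.inr (Or.inl (by rw [e]))
  · exact Or.inr (Or.inr (hle _ _ (by linarith) e))
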